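/- **Conventions.** Let $V$ be a finite, linearly ordered set of nodes. All edge matrices are binary. $\operatorname{In}[X]$ replaces every nonzero entry of $X$ by $1$; $X_{ab}$ is the block of $X$ with rows $a$ and columns $b$; ${\cal I}$ is an identity matrix. For a square binary matrix ${\cal F}$, a subset $a$ of its index set and its complement $b$, the partial closure is $$\operatorname{zer}_a{\cal F}=\operatorname{In}\begin{pmatrix}{\cal F}_{aa}^- & {\cal F}_{aa}^-{\cal F}_{ab}\\ {\cal F}_{ba}{\cal F}_{aa}^- & {\cal F}_{bb}+{\cal F}_{ba}{\cal F}_{aa}^-{\cal F}_{ab}\end{pmatrix},\qquad {\cal F}_{aa}^-=\operatorname{In}[((|a|+1){\cal I}_{aa}-{\cal F}_{aa})^{-1}].$$ The nodes of a *summary graph* are $N=u\cup v$ with $u,v$ disjoint. Its edge-matrix components are ${\cal H}_{uu}$ (arrows within $u$; unit upper-triangular), ${\cal H}_{uv}$ (arrows from $v$ to $u$), ${\cal W}_{uu}$ (dashed lines) and ${\cal S}^{vv}$ (full lines); the last two are symmetric with ones along the diagonal. An entry $1$ in position $(i,k)$, $i\ne k$, of ${\cal H}$ is the arrow $i\leftarrow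 k$. For a set $s$ of nodes and $c\subseteq s$, the *foster nodes* of $c$ in $s$ are the nodes of $s\setminus c$ from which a directed path within $s$ leads to a node of $c$. **Summary graph generated from a directed acyclic graph.** Let ${\cal A}$ be the (unit upper-triangular) edge matrix of a directed acyclic graph on $V$, and let $C,M\subseteq V$ be disjoint. Let $F$ be the set of foster nodes of $C$ in $V$, $R=C\cup F$, $O=V\setminus R$, $p=O\cap M$, $q=F\cap M$, $u=O\setminus p$, $v=F\setminus q$, ${\cal D}=\operatorname{zer}_p{\cal A}$, ${\cal S}^{FF.O}=\operatorname{In}[{\cal A}_{RR}^{T}{\cal A}_{RR}]_{FF}$ and $$\operatorname{zer}_q{\cal S}^{FF.O}=\begin{pmatrix}{\cal S}_{qq|vC}&{\cal P}_{q|v.C}\\ \cdot&{\cal S}^{vv.uM}\end{pmatrix}.$$ The graph $G^{V\setminus[C,M]}_{\rm sum}$ has node set $u\cup v$ and the components ${\cal H}_{uu}={\cal D}_{uu}$, ${\cal H}_{uv}=\operatorname{In}[{\cal D}_{uv}+{\cal D}_{uq}{\cal P}_{q|v.C}]$, ${\cal S}^{vv.uM}$ and ${\cal W}_{uu}=\operatorname{In}[{\cal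 I}_{uu}+{\cal D}_{up}{\cal D}_{up}^{T}+{\cal D}_{uq}{\cal S}_{qq|vC}{\cal D}_{uq}^{T}]$. **Reduction of a summary graph.** Let $G$ be a summary graph with nodes $\mu\cup\nu$ (in place of $u\cup v$) and components ${\cal B}_{\mu\mu},{\cal B}_{\mu\nu},{\cal W}'_{\mu\mu},{\cal S}^{\nu\nu}$ (arrows within $\mu$, arrows from $\nu$ to $\mu$, dashed lines, full lines), and let $c',m'$ be disjoint subsets of its nodes. Let $c_\mu=c'\cap\mu$, let $f_\mu$ be the set of foster nodes of $c_\mu$ in $\mu$, and put $r=c_\mu\cup f_\mu$, $o=\mu\setminus r$, $\psi=r\cup\nu$, $\phi=\psi\setminus c'$, $h=o\cap m'$, $l=\phi\cap m'$, $u=o\setminus h$, $v=\phi\setminus l$. Let $${\cal Q}=\operatorname{zer}_r{\cal W}'_{\mu\mu},\qquad {\cal C}_{o\psi}=\operatorname{In}[{\cal B}_{o\psi}+{\cal Q}_{or}{\cal B}_{r\psi}],\qquad {\cal K}=\operatorname{zer}_{h\cup l}\begin{pmatrix}{\cal B}_{oo}&{\cal C}_{o\phi}\\0&{\cal S}^{\phi\phi}\end{pmatrix},$$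 where ${\cal S}^{\phi\phi}$ is the $\phi\phi$-block of $${\cal S}^{\psi\psi}=\operatorname{In}\begin{pmatrix}{\cal B}_{rr}^T{\cal Q}_{rr}{\cal B}_{rr}&{\cal B}_{rr}^T{\cal Q}_{rr}{\cal B}_{r\nu}\\ \cdot&{\cal S}^{\nu\nu}+{\cal B}_{r\nu}^T{\cal Q}_{rr}{\cal B}_{r\nu}\end{pmatrix}$$ in the order $\psi=(r,\nu)$. Let ${\cal S}_{ll|vC}$ and ${\cal S}^{vv.uM}$ be the $ll$- and the $vv$-block of $\operatorname{zer}_l{\cal S}^{\phi\phi}$. The *reduction* of $G$ by $[c',m']$ has node set $u\cup v$ and the components ${\cal K}_{uu}$, ${\cal K}_{uv}$, ${\cal S}^{vv.uM}$ and $${\cal W}_{uu}=\operatorname{In}[{\cal Q}_{uu}+{\cal K}_{uh}{\cal Q}_{hu}+{\cal Q}_{uh}{\cal K}_{uh}^T+{\cal K}_{uh}{\cal Q}_{hh}{\cal K}_{uh}^T+{\cal K}_{ul}{\cal S}_{ll|vC}{\cal K}_{ul}^T].$$ **Corollary 5.** 1. Let ${\cal A}$ be the edge matrix of a directed acyclic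 graph on $V$, $c\subseteq C\subseteq V$ and $m\subseteq M\subseteq V$ with $C\cap M=\varnothing$. Then $G^{V\setminus[C,M]}_{\rm sum}$ is a summary graph with node set $V\setminus(C\cup M)$, and it equals the reduction of $G^{V\setminus[c,m]}_{\rm sum}$ by $[C\setminus c,\,M\setminus m]$: the sets $u,v$ and all four edge-matrix components coincide. 2. Hence summary graphs are closed under marginalising and conditioning, in any order: for every summary graph $G$ with node set $N$ and disjoint $c',m'\subseteq N$, the reduction of $G$ by $[c',m']$ is a summary graph with node set $N\setminus(c'\cup m')$; and for pairwise disjoint $c_1,m_1,c_2,m_2\subseteq N$, reducing $G$ by $[c_1,m_1]$ and the result by $[c_2,m_2]$ gives the same graph as reducing $G$ by $[c_1\cup c_2,m_1\cup m_2]$. -/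

import Mathlib

/-! All edge matrices are indexed by one ambient finite node set `V`, linearly ordered so that
arrows point from larger to smaller nodes (`i ← k` only if `i < k`). The block `X_ab` of a matrix
`X` is stored as the `V × V` matrix `blk a b X` that agrees with `X` on `a × b` and vanishes
elsewhere; products and sums of such padded matrices are the padded block products and sums. -/

noncomputable section

open scoped Matrix

namespace SummaryGraphs

variable {V : Type*}

/-- The indicator function `In[X]`: every nonzero entry is changed into a one. -/
def ind (X : Matrix V V ℝ) : Matrix V V ℝ :=
  fun i j => if X i j = 0 then 0 else 1

/-- The block `X_ab`, padded with zeros. -/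
def blk [DecidableEq V] (a b : Finset V) (X : Matrix V V ℝ) : Matrix V V ℝ :=
  fun i j => if i ∈ a ∧ j ∈ b then X i j else 0

/-- `F_aa⁻ = In[(n I_aa - F_aa)⁻¹]` with `n = |a| + 1`, padded with zeros. The inverse is
taken of the `V × V` matrix `n I - F_aa`, which is block diagonal, so that the `aa`-block of the
inverse is the inverse of the `aa`-block. -/
def closedBlock [Fintype V] [DecidableEq V] (a : Finset V) (F : Matrix V V ℝ) :
    Matrix V V ℝ :=
  ind (blk a a ((((a.card : ℝ) + 1) • (1 : Matrix V V ℝ) - blk a a F)⁻¹))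

/-- Partial closure `zer_a F`. With `b = V \ a`, its four blocks are `In` of
`F_aa⁻`, `F_aa⁻ F_ab`, `F_ba F_aa⁻` and `F_bb + F_ba F_aa⁻ F_ab`. -/
def zer [Fintype V] [DecidableEq V] (a : Finset V) (F : Matrix V V ℝ) : Matrix V V ℝ :=
  ind (closedBlock a F
    + closedBlock a F * blk a aᶜ F
    + blk aᶜ a F * closedBlock a F
    + ind (blk aᶜ aᶜ F + blk aᶜ a F * closedBlock a F * blk a aᶜ F))

/-- `k` is an ancestor of `i` within the node set `s`: there is a direction-preserving path
`i ← ⋯ ← k` with all nodes in `s`, of at least one arrow, where `i ← k` means `X i k ≠ 0`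
and `i ≠ k`. -/
def IsAncestor (X : Matrix V V ℝ) (s : Finset V) (i k : V) : Prop :=
  Relation.TransGen (fun i k => i ∈ s ∧ k ∈ s ∧ i ≠ k ∧ X i k ≠ 0) i k

open Classical in
/-- The foster nodes of `c` within `s`: the nodes of `s` outside `c` that are
ancestors, within `s`, of some node of `c`. -/
def foster (X : Matrix V V ℝ) (s c : Finset V) : Finset V :=
  s.filter (fun k => k ∉ c ∧ ∃ i ∈ c, IsAncestor X s i k)

/-- The edge matrix of a directed acyclic graph (parent graph) with node set `V`: binary, unit
upper-triangular. -/
structure IsParentEdgeMatrix [LinearOrder V] (A : Matrix V V ℝ) : Prop where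
  binary : ∀ i k, A i k = 0 ∨ A i k = 1
  diag : ∀ i, A i i = 1
  upper : ∀ i k, k < i → A i k = 0

/-- Edge matrix components of a graph on the nodes `(u, v)`: arrows
`dir = (H_uu, H_uv)` (entry `(i, k)` for `i ← k`), dashed lines `dash = W_uu`,
full lines `full = S^vv`. -/
@[ext]
structure EdgeMatrices (V : Type*) where
  u : Finset V
  v : Finset V
  dir : Matrix V V ℝ
  dash : Matrix V V ℝ
  full : Matrix V V ℝ

/-- A summary graph: `u` and `v` are disjoint; within `u` there is a directed acyclic graph
(compatible with the order of `V`) and a covariance graph, within `v` a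
concentration graph, and between `u` and `v` only arrows from `v` to `u`.
Edge matrices are binary and have ones along the diagonal. -/
structure IsSummaryGraph [LinearOrder V] (G : EdgeMatrices V) : Prop where
  disjoint : Disjoint G.u G.v
  dir_binary : ∀ i k, G.dir i k = 0 ∨ G.dir i k = 1
  dash_binary : ∀ i k, G.dash i k = 0 ∨ G.dash i k = 1
  full_binary : ∀ i k, G.full i k = 0 ∨ G.full i k = 1
  dir_supp : ∀ i k, G.dir i k ≠ 0 → i ∈ G.u ∧ k ∈ G.u ∪ G.v
  dash_supp : ∀ i k, G.dash i k ≠ 0 → i ∈ G.u ∧ k ∈ G.u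
  full_supp : ∀ i k, G.full i k ≠ 0 → i ∈ G.v ∧ k ∈ G.v
  dir_diag : ∀ i ∈ G.u, G.dir i i = 1
  dash_diag : ∀ i ∈ G.u, G.dash i i = 1
  full_diag : ∀ i ∈ G.v, G.full i i = 1
  dir_upper : ∀ i ∈ G.u, ∀ k ∈ G.u, k < i → G.dir i k = 0
  dash_symm : ∀ i k, G.dash i k = G.dash k i
  full_symm : ∀ i k, G.full i k = G.full k i

/-! ### The summary graph generated from a parent graph -/

/-- The summary graph for `[C, M]` generated from the parent graph with edge matrix `A` by
conditioning on `C` and marginalising over `M`. Here `F` are the foster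
nodes of `C`, `R = C ∪ F`, `O = V \ R`, `M = p ∪ q` with `p ⊆ O` and `q ⊆ F`, and
`S^{FF.O}` is the `FF`-block of `S^{RR.O} = In[A_RRᵀ A_RR]`. -/
def ofParent [Fintype V] [LinearOrder V] (A : Matrix V V ℝ) (C M : Finset V) :
    EdgeMatrices V :=
  let F := foster A Finset.univ C
  let R := C ∪ F
  let O := Rᶜ
  let p := O ∩ M
  let q := F ∩ M
  let u := O \ p
  let v := F \ q
  let D := zer p A
  -- blocks of `Z`: `S_{qq|vC}`, `P_{q|v.C}` and `S^{vv.qO} = S^{vv.uM}`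
  let Z := zer q (blk F F (ind ((blk R R A)ᵀ * blk R R A)))
  { u := u
    v := v
    dir := blk u u D + ind (blk u v D + blk u q D * blk q v Z)
    dash := ind ((blk u u 1 + blk u p D * (blk u p D)ᵀ)
      + blk u q D * blk q q Z * (blk u q D)ᵀ)
    full := blk v v Z }

/-! ### Generating a summary graph from a larger summary graph

`G` has nodes `(μ, ν) = (G.u, G.v)`, arrows `B = G.dir`, dashed lines `W' = G.dash`, and full
lines `S^{νν.μm} = G.full`. The additional conditioning set is `c` and the additional
marginalising set is `m`. -/

namespace EdgeMatrices

variable [Fintype V] [LinearOrder V] (G : EdgeMatrices V) (c m : Finset V)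

/-- The node set `N = u ∪ v`. -/
def nodes (G : EdgeMatrices V) : Finset V := G.u ∪ G.v

/-- `r = c_μ ∪ f_μ`, with `c_μ = c ∩ μ` and `f_μ` its foster nodes in `μ`. -/
def rSet : Finset V := (c ∩ G.u) ∪ foster G.dir G.u (c ∩ G.u)

/-- The outsiders `o = μ \ r`. -/
def oSet : Finset V := G.u \ G.rSet c

/-- `ψ = r ∪ ν`. -/
def psiSet : Finset V := G.rSet c ∪ G.v

/-- `φ = ψ \ c`. -/
def phiSet : Finset V := G.psiSet c \ c

/-- `h`, the part of the marginalising set within `o`. -/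
def hSet : Finset V := G.oSet c ∩ m

/-- `l`, the part of the marginalising set within `φ`. -/
def lSet : Finset V := G.phiSet c ∩ m

/-- The new `u = o \ h`. -/
def uSet : Finset V := G.oSet c \ G.hSet c m

/-- The new `v = φ \ l`. -/
def vSet : Finset V := G.phiSet c \ G.lSet c m

/-- `Q_μμ = zer_r W'_μμ`. -/
def Q : Matrix V V ℝ := zer (G.rSet c) G.dash

/-- `C_oψ = In[B_oψ + Q_or B_rψ]`. -/
def Cmat : Matrix V V ℝ :=
  ind (blk (G.oSet c) (G.psiSet c) G.dir
    + blk (G.oSet c) (G.rSet c) (G.Q c) * blk (G.rSet c) (G.psiSet c) G.dir)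

/-- `S^{ψψ.om}`: `In` of the matrix with blocks `B_rrᵀ Q_rr B_rr`,
`B_rrᵀ Q_rr B_rν` and `S^{νν.μm} + B_rνᵀ Q_rr B_rν` in the order `ψ = (r, ν)`. -/
def Spsi : Matrix V V ℝ :=
  ind (G.full + (blk (G.rSet c) (G.psiSet c) G.dir)ᵀ
    * blk (G.rSet c) (G.rSet c) (G.Q c) * blk (G.rSet c) (G.psiSet c) G.dir)

/-- `K = zer_{hl}` of the block-triangular matrix with blocks `B_oo`, `C_oφ`, `0`,
`S^{φφ.om}`. -/
def K : Matrix V V ℝ :=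
  zer (G.hSet c m ∪ G.lSet c m)
    (blk (G.oSet c) (G.oSet c) G.dir + blk (G.oSet c) (G.phiSet c) (G.Cmat c)
      + blk (G.phiSet c) (G.phiSet c) (G.Spsi c))

/-- `zer_l S^{φφ.om}`, with `ll`-block `S_{ll|vC}` and `vv`-block `S^{vv.uM}`. -/
def Z : Matrix V V ℝ :=
  zer (G.lSet c m) (blk (G.phiSet c) (G.phiSet c) (G.Spsi c))

/-- The edge matrix components obtained from those of `G` by additional conditioning on `c` and
marginalising over `m`: `K_uu`, `K_uv`, `S^{vv.uM}` and
`W_uu = In[Q_uu + K_uh Q_hu + Q_uh K_uhᵀ + K_uh Q_hh K_uhᵀ + K_ul S_{ll|vC} K_ulᵀ]`. -/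
def reduce : EdgeMatrices V :=
  let h := G.hSet c m
  let l := G.lSet c m
  let u := G.uSet c m
  let v := G.vSet c m
  { u := u
    v := v
    dir := blk u u (G.K c m) + blk u v (G.K c m)
    dash := ind (blk u u (G.Q c)
      + blk u h (G.K c m) * blk h u (G.Q c)
      + blk u h (G.Q c) * (blk u h (G.K c m))ᵀ
      + blk u h (G.K c m) * blk h h (G.Q c) * (blk u h (G.K c m))ᵀ
      + blk u l (G.K c m) * blk l l (G.Z c m) * (blk u l (G.K c m))ᵀ)
    full := blk v v (G.Z c m) }

end EdgeMatrices

end SummaryGraphs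

end

/-! Call a walk connecting if each of its inner nodes is a collider in `r`, that is, an ancestor of
or in the conditioning set, or a noncollider in the marginalising set. Partial closure of a binary
matrix `F` with respect to `a` records the walks with inner nodes in `a`, since
`((|a| + 1) I - F_aa)⁻¹` is positive exactly where some power of `F_aa` is. Hence the edges of the
reduction of a summary graph are the pairs of edge-ends joined by a connecting walk, a description
in which heads and tails are treated alike. Now two reductions compose because walks do: replacing
every edge of the reduced graph by a connecting walk gives a connecting walk for the united sets,
and conversely such a walk can be cut at the nodes which survive the first reduction. Finally, the
summary graph generated from a directed acyclic graph is the reduction of that graph, viewed as a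
summary graph whose only dashed lines are the loops on the diagonal. -/

open scoped Matrix

namespace SummaryGraphs

/-! ### Walks -/

section Walk

variable {α : Type*}

/-- `Walk L R a b`: one can pass from `a` to `b` by `R`-steps, any two successive ones being joined
by an `L`-link. In a graph, the steps are edges between edge-ends and a link `L p q` says that a
walk may enter a node through the end `p` and leave it through the end `q`. -/
inductive Walk (L R : α → α → Prop) (a : α) : α → Prop
  | single {b : α} (h : R a b) : Walk L R a b
  | snoc {p q b : α} (h : Walk L R a p) (hL : L p q) (hR : R q b) : Walk L R a b

/-- The links of an ordinary path whose inner points lie in `s`. -/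
def Pass (s : Finset α) (x y : α) : Prop := x ∈ s ∧ x = y

namespace Walk

variable {L L' L₁ L₂ R R' : α → α → Prop} {S : α → Prop} {a b p q : α} {s : Finset α}

theorem trans (h : Walk L R a p) (hL : L p q) (h' : Walk L R q b) : Walk L R a b := by
  induction h' with
  | single hR => exact h.snoc hL hR
  | snoc _ hL' hR ih => exact ih.snoc hL' hR

theorem symm (hL : ∀ p q, L p q → L q p) (hR : ∀ p q, R p q → R q p) (h : Walk L R a b) :
    Walk L R b a := by
  induction h with
  | single h => exact .single (hR _ _ h)
  | snoc _ hpq hqb ih => exact (single (hR _ _ hqb)).trans (hL _ _ hpq) ih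

theorem iff_tail : Walk L R a b ↔ R a b ∨ ∃ p q, Walk L R a p ∧ L p q ∧ R q b := by
  constructor
  · rintro (h | ⟨h, hL, hR⟩)
    exacts [.inl h, .inr ⟨_, _, h, hL, hR⟩]
  · rintro (h | ⟨p, q, h, hL, hR⟩)
    exacts [.single h, h.snoc hL hR]

theorem iff_head : Walk L R a b ↔ R a b ∨ ∃ p q, R a p ∧ L p q ∧ Walk L R q b := by
  constructor
  · intro h
    induction h with
    | single h => exact .inl h
    | snoc _ hL hR ih =>
      rcases ih with h | ⟨p, q, h, hL', h'⟩
      exacts [.inr ⟨_, _, h, hL, .single hR⟩, .inr ⟨p, q, h, hL', h'.snoc hL hR⟩]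
  · rintro (h | ⟨p, q, h, hL, h'⟩)
    exacts [.single h, (single h).trans hL h']

theorem pass_iff_tail : Walk (Pass s) R a b ↔ R a b ∨ ∃ x ∈ s, Walk (Pass s) R a x ∧ R x b := by
  rw [iff_tail]
  simp only [Pass]
  grind

theorem pass_iff_head : Walk (Pass s) R a b ↔ R a b ∨ ∃ x ∈ s, R a x ∧ Walk (Pass s) R x b := by
  rw [iff_head]
  simp only [Pass]
  grind

theorem flatten (hL : ∀ {a p q b}, Walk L R a p → L' p q → Walk L R q b → Walk L R a b)
    (hR : ∀ {a b}, R' a b → Walk L R a b) (h : Walk L' R' a b) : Walk L R a b := by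
  induction h with
  | single h => exact hR h
  | snoc _ hpq hqb ih => exact hL ih hpq (hR hqb)

theorem sup_iff : Walk (L₁ ⊔ L₂) R a b ↔ Walk L₂ (Walk L₁ R) a b := by
  constructor
  · intro h
    induction h with
    | single h => exact .single (.single h)
    | snoc _ hL hR ih =>
      rcases hL with hL | hL
      · rcases ih with h | ⟨h, hL', h'⟩
        exacts [.single (h.snoc hL hR), h.snoc hL' (h'.snoc hL hR)]
      · exact ih.snoc hL (.single hR)
  · exact flatten (fun h hL => h.trans (.inr hL))
      (flatten (fun h hL => h.trans (.inl hL)) .single)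

/-- The detour through `p'` and `q'` absorbs an end of each neighbouring segment, so that every
segment starts and ends in `S`. -/
theorem cut (hL : ∀ p q, L p q → L₁ p q ∨ ∃ p' q', S p' ∧ S q' ∧ L₂ p' q' ∧
      (∀ a, Walk L₁ R a p → Walk L₁ R a p') ∧ ∀ b, Walk L₁ R q b → Walk L₁ R q' b)
    (ha : S a) (hb : S b) (h : Walk L R a b) :
    Walk L₂ (fun a b => S a ∧ S b ∧ Walk L₁ R a b) a b := by
  suffices key : Walk L₁ R a b ∨
      ∃ p q, Walk L₂ (fun a b => S a ∧ S b ∧ Walk L₁ R a b) a p ∧ L₂ p q ∧ S q ∧ Walk L₁ R q b by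
    rcases key with h | ⟨p, q, h, hpq, hq, h'⟩
    exacts [.single ⟨ha, hb, h⟩, h.snoc hpq ⟨hq, hb, h'⟩]
  clear hb
  induction h with
  | single h => exact .inl (.single h)
  | snoc _ hpq hR ih =>
    rcases hL _ _ hpq with hpq | ⟨p', q', hp', hq', hpq', hp, hq⟩
    · exact ih.imp (·.snoc hpq hR) fun ⟨x, y, h, hxy, hy, h'⟩ => ⟨x, y, h, hxy, hy, h'.snoc hpq hR⟩
    · refine .inr ⟨p', q', ?_, hpq', hq', hq _ (.single hR)⟩
      rcases ih with h | ⟨x, y, h, hxy, hy, h'⟩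
      exacts [.single ⟨ha, hp', hp _ h⟩, h.snoc hxy ⟨hy, hp', hp _ h'⟩]

end Walk

end Walk

/-! ### The resolvent of a nonnegative matrix -/

section Resolvent

theorem smul_one_sub_mulVec {n R : Type*} [Fintype n] [DecidableEq n] [CommRing R]
    (B : Matrix n n R) (t : R) (x : n → R) (i : n) :
    ((t • (1 : Matrix n n R) - B) *ᵥ x) i = t * x i - ∑ k, B i k * x k := by
  rw [Matrix.sub_mulVec, Matrix.smul_mulVec, Matrix.one_mulVec]
  rfl

variable {n K : Type*} [Fintype n] [Field K] [LinearOrder K] [IsStrictOrderedRing K]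
  {B : Matrix n n K} {t : K}

/-- The maximum principle: look at a row where `x` is largest. -/
theorem nonpos_of_mul_le_sum (hB : ∀ i j, 0 ≤ B i j) (ht : ∀ i, ∑ k, B i k < t) {s : Finset n}
    {x : n → K} (hx : ∀ i ∈ s, t * x i ≤ ∑ k ∈ s, B i k * x k) : ∀ i ∈ s, x i ≤ 0 := by
  by_contra! ⟨i₀, hi₀, hpos⟩
  obtain ⟨i, hi, hmax⟩ := s.exists_max_image x ⟨i₀, hi₀⟩
  have hxi : 0 < x i := hpos.trans_le (hmax i₀ hi₀)
  have : t * x i < t * x i :=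
    calc t * x i ≤ ∑ k ∈ s, B i k * x k := hx i hi
      _ ≤ ∑ k ∈ s, B i k * x i :=
        Finset.sum_le_sum fun k hk => mul_le_mul_of_nonneg_left (hmax k hk) (hB i k)
      _ = (∑ k ∈ s, B i k) * x i := (Finset.sum_mul ..).symm
      _ ≤ (∑ k, B i k) * x i := mul_le_mul_of_nonneg_right
        (Finset.sum_le_univ_sum_of_nonneg (hB i)) hxi.le
      _ < t * x i := mul_lt_mul_of_pos_right (ht i) hxi
  exact this.false

variable [DecidableEq n]

theorem isUnit_det_smul_one_sub (hB : ∀ i j, 0 ≤ B i j) (ht : ∀ i, ∑ k, B i k < t) :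
    IsUnit (t • (1 : Matrix n n K) - B).det := by
  have nonpos : ∀ x, (t • (1 : Matrix n n K) - B) *ᵥ x = 0 → ∀ i, x i ≤ 0 := fun x hx i =>
    nonpos_of_mul_le_sum hB ht (s := Finset.univ)
      (fun i _ => (sub_eq_zero.1 ((smul_one_sub_mulVec B t x i).symm.trans (congrFun hx i))).le)
      i (Finset.mem_univ i)
  rw [isUnit_iff_ne_zero]
  intro hdet
  obtain ⟨x, hx₀, hx⟩ := Matrix.exists_mulVec_eq_zero_iff.2 hdet
  refine hx₀ (funext fun i => le_antisymm (nonpos x hx i) ?_)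
  simpa using nonpos (-x) (by rw [Matrix.mulVec_neg, hx, neg_zero]) i

theorem mul_smul_one_sub_inv_apply (hB : ∀ i j, 0 ≤ B i j) (ht : ∀ i, ∑ k, B i k < t) (i j : n) :
    t * (t • (1 : Matrix n n K) - B)⁻¹ i j
      = (1 : Matrix n n K) i j + ∑ k, B i k * (t • (1 : Matrix n n K) - B)⁻¹ k j := by
  rw [← sub_eq_iff_eq_add, ← smul_one_sub_mulVec B t fun k => (t • 1 - B)⁻¹ k j]
  exact congrFun (congrFun (Matrix.mul_nonsing_inv _ (isUnit_det_smul_one_sub hB ht)) i) j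

theorem smul_one_sub_inv_nonneg (hB : ∀ i j, 0 ≤ B i j) (ht : ∀ i, ∑ k, B i k < t) (i j : n) :
    0 ≤ (t • (1 : Matrix n n K) - B)⁻¹ i j := by
  refine neg_nonpos.1 (nonpos_of_mul_le_sum hB ht (s := Finset.univ)
    (x := fun k => -(t • (1 : Matrix n n K) - B)⁻¹ k j) (fun i _ => ?_) i (Finset.mem_univ i))
  have hone : (0 : K) ≤ (1 : Matrix n n K) i j := by
    rw [Matrix.one_apply]; split_ifs <;> simp
  simp only [mul_neg, Finset.sum_neg_distrib, mul_smul_one_sub_inv_apply hB ht i j]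
  linarith

theorem smul_one_sub_inv_ne_zero_iff (hB : ∀ i j, 0 ≤ B i j) (ht : ∀ i, ∑ k, B i k < t)
    (i j : n) : (t • (1 : Matrix n n K) - B)⁻¹ i j ≠ 0 ↔
      Relation.ReflTransGen (fun p q => B p q ≠ 0) i j := by
  classical
  set X := (t • (1 : Matrix n n K) - B)⁻¹
  have fixed (i) : t * X i j = (1 : Matrix n n K) i j + ∑ k, B i k * X k j :=
    mul_smul_one_sub_inv_apply hB ht i j
  have nonneg (i) : 0 ≤ X i j := smul_one_sub_inv_nonneg hB ht i j
  have term_nonneg (i k) : 0 ≤ B i k * X k j := mul_nonneg (hB i k) (nonneg k)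
  constructor
  · intro hij
    by_contra hunreachable
    -- No step leads from a point that does not reach `j` to one that does.
    refine hij (le_antisymm (nonpos_of_mul_le_sum hB ht (x := (X · j))
      (s := {i | ¬ Relation.ReflTransGen (fun p q => B p q ≠ 0) i j}) (fun i hi => ?_) i
      (by simpa using hunreachable)) (nonneg i))
    simp only [Finset.mem_filter, Finset.mem_univ, true_and] at hi
    rw [fixed, Matrix.one_apply_ne (by rintro rfl; exact hi .refl), zero_add]
    refine (Finset.sum_subset (Finset.subset_univ _) fun k _ hk => ?_).ge
    simp only [Finset.mem_filter, Finset.mem_univ, true_and, not_not] at hk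
    rw [not_not.1 fun hik => hi (.head hik hk), zero_mul]
  · intro h
    induction h using Relation.ReflTransGen.head_induction_on with
    | refl =>
      intro h₀
      have := fixed j
      rw [h₀, mul_zero, Matrix.one_apply_eq] at this
      linarith [Finset.sum_nonneg fun k (_ : k ∈ Finset.univ) => term_nonneg j k]
    | @head i k hik _ ih =>
      intro h₀
      have hone : (0 : K) ≤ (1 : Matrix n n K) i j := by
        rw [Matrix.one_apply]; split_ifs <;> simp
      have hpos : 0 < B i k * X k j := mul_pos ((hB i k).lt_of_ne' hik) ((nonneg k).lt_of_ne' ih)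
      have hle := Finset.single_le_sum (fun k _ => term_nonneg i k) (Finset.mem_univ k)
      have := fixed i
      rw [h₀, mul_zero] at this
      linarith

end Resolvent

/-! ### Supports of nonnegative matrices -/

section Support

variable {V : Type*} {X Y : Matrix V V ℝ} {a b : Finset V} {i j : V}

/-- All entries are nonnegative. A class, so that supports of the sums and products occurring in
edge matrices are computed by rewriting. -/
class NonnegEntries {V : Type*} (X : Matrix V V ℝ) : Prop where
  nonneg : ∀ i j, 0 ≤ X i j

/-- All entries are `0` or `1`. -/
def IsBinary (X : Matrix V V ℝ) : Prop := ∀ i j, X i j = 0 ∨ X i j = 1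

theorem IsBinary.nonnegEntries (hX : IsBinary X) : NonnegEntries X :=
  ⟨fun i j => by rcases hX i j with h | h <;> simp [h]⟩

theorem IsBinary.le_one (hX : IsBinary X) (i j : V) : X i j ≤ 1 := by
  rcases hX i j with h | h <;> simp [h]

theorem IsBinary.eq_one (hX : IsBinary X) (h : X i j ≠ 0) : X i j = 1 :=
  (hX i j).resolve_left h

theorem IsBinary.ext (hX : IsBinary X) (hY : IsBinary Y) (h : ∀ i j, X i j ≠ 0 ↔ Y i j ≠ 0) :
    X = Y := by
  ext i j
  rcases hX i j with hx | hx <;> rcases hY i j with hy | hy <;> have := h i j <;> simp_all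

theorem IsBinary.apply_comm (hX : IsBinary X) (h : ∀ i j, X i j ≠ 0 → X j i ≠ 0) (i j : V) :
    X i j = X j i :=
  congrFun₂ (IsBinary.ext (Y := Xᵀ) hX (fun i j => hX j i) fun i j => ⟨h i j, h j i⟩) i j

theorem IsBinary.add (hX : IsBinary X) (hY : IsBinary Y) (h : ∀ i j, X i j ≠ 0 → Y i j = 0) :
    IsBinary (X + Y) := by
  intro i j
  rw [Matrix.add_apply]
  rcases hX i j with hx | hx
  · rw [hx, zero_add]
    exact hY i j
  · rw [h i j (by simp [hx]), add_zero]
    exact hX i j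

theorem isBinary_ind (X : Matrix V V ℝ) : IsBinary (ind X) := fun i j => by
  unfold ind
  split_ifs <;> simp

theorem IsBinary.blk [DecidableEq V] (hX : IsBinary X) (a b : Finset V) : IsBinary (blk a b X) := by
  intro i j
  unfold SummaryGraphs.blk
  split_ifs
  exacts [hX i j, .inl rfl]

instance : NonnegEntries (ind X) := (isBinary_ind X).nonnegEntries

instance [DecidableEq V] [hX : NonnegEntries X] : NonnegEntries (blk a b X) :=
  ⟨fun i j => by unfold blk; split_ifs; exacts [hX.nonneg i j, le_rfl]⟩

instance [hX : NonnegEntries X] [hY : NonnegEntries Y] : NonnegEntries (X + Y) :=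
  ⟨fun i j => add_nonneg (hX.nonneg i j) (hY.nonneg i j)⟩

instance [Fintype V] [hX : NonnegEntries X] [hY : NonnegEntries Y] : NonnegEntries (X * Y) :=
  ⟨fun i j => Finset.sum_nonneg fun k _ => mul_nonneg (hX.nonneg i k) (hY.nonneg k j)⟩

instance [hX : NonnegEntries X] : NonnegEntries Xᵀ := ⟨fun i j => hX.nonneg j i⟩

theorem isBinary_one [DecidableEq V] : IsBinary (1 : Matrix V V ℝ) := fun i j => by
  rw [Matrix.one_apply]
  split_ifs <;> simp

instance [DecidableEq V] : NonnegEntries (1 : Matrix V V ℝ) := isBinary_one.nonnegEntries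

theorem ind_ne_zero : ind X i j ≠ 0 ↔ X i j ≠ 0 := by
  unfold ind
  split_ifs with h <;> simp [h]

theorem blk_ne_zero [DecidableEq V] : blk a b X i j ≠ 0 ↔ i ∈ a ∧ j ∈ b ∧ X i j ≠ 0 := by
  unfold blk
  split_ifs <;> simp_all

theorem add_ne_zero [hX : NonnegEntries X] [hY : NonnegEntries Y] :
    (X + Y) i j ≠ 0 ↔ X i j ≠ 0 ∨ Y i j ≠ 0 := by
  rw [Matrix.add_apply, Ne, add_eq_zero_iff_of_nonneg (hX.nonneg i j) (hY.nonneg i j)]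
  tauto

theorem mul_ne_zero [Fintype V] [hX : NonnegEntries X] [hY : NonnegEntries Y] :
    (X * Y) i j ≠ 0 ↔ ∃ k, X i k ≠ 0 ∧ Y k j ≠ 0 := by
  rw [Matrix.mul_apply, Ne, Finset.sum_eq_zero_iff_of_nonneg
    fun k _ => mul_nonneg (hX.nonneg i k) (hY.nonneg k j)]
  simp

theorem one_ne_zero_iff [DecidableEq V] : (1 : Matrix V V ℝ) i j ≠ 0 ↔ i = j := by
  rw [Matrix.one_apply]
  split_ifs with h <;> simp [h]

end Support

/-! ### The partial closure -/

section Zer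

variable {V : Type*} [DecidableEq V] {a : Finset V} {F : Matrix V V ℝ} {i j : V}

theorem reflTransGen_blk_iff (hi : i ∈ a) (hj : j ∈ a) :
    Relation.ReflTransGen (fun p q => blk a a F p q ≠ 0) i j ↔
      i = j ∨ Walk (Pass a) (fun p q => F p q ≠ 0) i j := by
  constructor
  · intro h
    clear hj
    induction h with
    | refl => exact .inl rfl
    | tail _ hbc ih =>
      obtain ⟨hb, -, hbc⟩ := blk_ne_zero.1 hbc
      rcases ih with rfl | h
      exacts [.inr (.single hbc), .inr (h.snoc ⟨hb, rfl⟩ hbc)]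
  · rintro (rfl | h)
    · exact .refl
    · induction h with
      | single h => exact .single (blk_ne_zero.2 ⟨hi, hj, h⟩)
      | snoc _ hpq hqb ih =>
        obtain ⟨hp, rfl⟩ := hpq
        exact (ih hp).tail (blk_ne_zero.2 ⟨hp, hj, hqb⟩)

variable [Fintype V]

instance : NonnegEntries (closedBlock a F) := by unfold closedBlock; infer_instance

instance : NonnegEntries (zer a F) := by unfold zer; infer_instance

theorem isBinary_zer (a : Finset V) (F : Matrix V V ℝ) : IsBinary (zer a F) := isBinary_ind _

theorem sum_blk_le_card (hF : IsBinary F) (a b : Finset V) (i : V) :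
    ∑ k, blk a b F i k ≤ b.card := by
  calc ∑ k, blk a b F i k ≤ ∑ k, if k ∈ b then (1 : ℝ) else 0 := Finset.sum_le_sum fun k _ => by
        unfold blk
        split_ifs with h₁ h₂ h₂
        exacts [hF.le_one i k, absurd h₁.2 h₂, zero_le_one, le_rfl]
    _ = b.card := by simp

theorem closedBlock_ne_zero (hF : IsBinary F) : closedBlock a F i j ≠ 0 ↔
    i ∈ a ∧ j ∈ a ∧ (i = j ∨ Walk (Pass a) (fun p q => F p q ≠ 0) i j) := by
  have := hF.nonnegEntries
  have nonneg (i j) : 0 ≤ blk a a F i j := NonnegEntries.nonneg i j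
  have row_lt (i) : ∑ k, blk a a F i k < a.card + 1 :=
    (sum_blk_le_card hF a a i).trans_lt (lt_add_one _)
  rw [closedBlock, ind_ne_zero, blk_ne_zero, smul_one_sub_inv_ne_zero_iff nonneg row_lt]
  exact and_congr_right fun hi => and_congr_right fun hj => reflTransGen_blk_iff hi hj

theorem zer_ne_zero (hF : IsBinary F) : zer a F i j ≠ 0 ↔
    (i ∈ a ∧ i = j) ∨ Walk (Pass a) (fun p q => F p q ≠ 0) i j := by
  have := hF.nonnegEntries
  simp only [zer, ind_ne_zero, add_ne_zero, mul_ne_zero, blk_ne_zero, closedBlock_ne_zero hF,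
    Finset.mem_compl]
  set W := Walk (Pass a) (fun p q => F p q ≠ 0)
  constructor
  · have single {i j} (h : F i j ≠ 0) : W i j := .single h
    have trans {i j k} (hj : j ∈ a) (h : W i j) : W j k → W i k := h.trans ⟨hj, rfl⟩
    grind
  · have head {i j} : W i j → F i j ≠ 0 ∨ ∃ x ∈ a, F i x ≠ 0 ∧ W x j := Walk.pass_iff_head.1
    have tail {i j} : W i j → F i j ≠ 0 ∨ ∃ x ∈ a, W i x ∧ F x j ≠ 0 := Walk.pass_iff_tail.1
    rintro (⟨hi, rfl⟩ | h)
    · exact .inl (.inl (.inl ⟨hi, hi, .inl rfl⟩))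
    · by_cases hi : i ∈ a <;> by_cases hj : j ∈ a
      · exact .inl (.inl (.inl ⟨hi, hj, .inr h⟩))
      · rcases tail h with h | ⟨x, hx, hix, hxj⟩
        exacts [.inl (.inl (.inr ⟨i, ⟨hi, hi, .inl rfl⟩, hi, hj, h⟩)),
          .inl (.inl (.inr ⟨x, ⟨hi, hx, .inr hix⟩, hx, hj, hxj⟩))]
      · rcases head h with h | ⟨x, hx, hix, hxj⟩
        exacts [.inl (.inr ⟨j, ⟨hi, hj, h⟩, hj, hj, .inl rfl⟩),
          .inl (.inr ⟨x, ⟨hi, hx, hix⟩, hx, hj, .inr hxj⟩)]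
      · rcases head h with h | ⟨x, hx, hix, hxj⟩
        · exact .inr (.inl ⟨hi, hj, h⟩)
        · rcases tail hxj with h | ⟨y, hy, hxy, hyj⟩
          exacts [.inr (.inr ⟨x, ⟨x, ⟨hi, hx, hix⟩, hx, hx, .inl rfl⟩, hx, hj, h⟩),
            .inr (.inr ⟨y, ⟨x, ⟨hi, hx, hix⟩, hx, hy, .inr hxy⟩, hy, hj, hyj⟩)]

theorem zer_one : zer a (1 : Matrix V V ℝ) = 1 := by
  refine (isBinary_zer _ _).ext isBinary_one fun i j => (zer_ne_zero isBinary_one).trans ?_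
  rw [one_ne_zero_iff]
  constructor
  · rintro (⟨-, h⟩ | h)
    · exact h
    · induction h with
      | single h => exact one_ne_zero_iff.1 h
      | snoc _ hpq hqb ih => exact ih.trans (hpq.2.trans (one_ne_zero_iff.1 hqb))
  · exact fun h => .inr (.single (one_ne_zero_iff.2 h))

end Zer

/-! ### Connecting walks -/

/-- An end of an edge at a node: dashed lines have two heads, full lines two tails, and an arrow
`i ← k` has a head at `i` and a tail at `k`. -/
inductive EdgeEnd (V : Type*)
  | head (i : V)
  | tail (i : V)

namespace EdgeMatrices

open EdgeEnd

section Joins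

variable {V : Type*} {G : EdgeMatrices V} {a b : EdgeEnd V}

/-- Some edge of `G` has the two given ends. The ones along the diagonals of the edge matrices
count as edges. -/
def Joins (G : EdgeMatrices V) : EdgeEnd V → EdgeEnd V → Prop
  | head i, head j => G.dash i j ≠ 0
  | head i, tail k => G.dir i k ≠ 0
  | tail k, head i => G.dir i k ≠ 0
  | tail i, tail j => G.full i j ≠ 0

variable [LinearOrder V]

/-- The ends which edges of `G` can have: only nodes of `u` have heads. -/
def IsEnd (G : EdgeMatrices V) : EdgeEnd V → Prop
  | head i => i ∈ G.u
  | tail k => k ∈ G.nodes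

theorem joins_symm (hG : IsSummaryGraph G) (h : G.Joins a b) : G.Joins b a := by
  cases a <;> cases b <;> simp only [Joins] at h ⊢
  exacts [hG.dash_symm _ _ ▸ h, h, h, hG.full_symm _ _ ▸ h]

theorem joins_head_tail_self (hG : IsSummaryGraph G) {i : V} (hi : i ∈ G.u) :
    G.Joins (head i) (tail i) := by
  simp [Joins, hG.dir_diag i hi]

theorem joins_head_head_self (hG : IsSummaryGraph G) {i : V} (hi : i ∈ G.u) :
    G.Joins (head i) (head i) := by
  simp [Joins, hG.dash_diag i hi]

theorem ext_of_joins {G' : EdgeMatrices V} (hG : IsSummaryGraph G) (hG' : IsSummaryGraph G')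
    (hu : G.u = G'.u) (hnodes : G.nodes = G'.nodes) (hjoins : ∀ a b, G.Joins a b ↔ G'.Joins a b) :
    G = G' := by
  refine EdgeMatrices.ext hu ?_ (IsBinary.ext hG.dir_binary hG'.dir_binary fun i k =>
      hjoins (head i) (tail k)) (IsBinary.ext hG.dash_binary hG'.dash_binary fun i j =>
      hjoins (head i) (head j)) (IsBinary.ext hG.full_binary hG'.full_binary fun i j =>
      hjoins (tail i) (tail j))
  rw [← Finset.union_sdiff_cancel_left hG.disjoint, ← Finset.union_sdiff_cancel_left hG'.disjoint]
  exact congrArg₂ (· \ ·) hnodes hu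

end Joins

section Connects

variable {V : Type*} [LinearOrder V] {G : EdgeMatrices V} {c m : Finset V} {a b : EdgeEnd V}
  {i k x : V}

/-- A walk may pass a collider if it lies in `r`. -/
inductive ColliderLink (G : EdgeMatrices V) (c : Finset V) : EdgeEnd V → EdgeEnd V → Prop
  | mk {x : V} (hx : x ∈ G.rSet c) : ColliderLink G c (head x) (head x)

/-- A walk may pass a noncollider if it is marginalised over. There is no need for links between
the two kinds of ends at nodes of `l`: such a node has a head only if it lies in `r`, and then the
loop with ends `head x` and `tail x` does the same. -/
inductive NoncolliderLink (G : EdgeMatrices V) (c m : Finset V) : EdgeEnd V → EdgeEnd V → Prop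
  | tails {x : V} (hx : x ∈ G.hSet c m ∪ G.lSet c m) : NoncolliderLink G c m (tail x) (tail x)
  | up {x : V} (hx : x ∈ G.hSet c m) : NoncolliderLink G c m (head x) (tail x)
  | down {x : V} (hx : x ∈ G.hSet c m) : NoncolliderLink G c m (tail x) (head x)

/-- Walks all of whose inner nodes are colliders in `r`. -/
def ColliderWalk (G : EdgeMatrices V) (c : Finset V) : EdgeEnd V → EdgeEnd V → Prop :=
  Walk (G.ColliderLink c) G.Joins

/-- The connecting walks after conditioning on `c` and marginalising over `m`. -/
def Connects (G : EdgeMatrices V) (c m : Finset V) : EdgeEnd V → EdgeEnd V → Prop :=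
  Walk (G.ColliderLink c ⊔ G.NoncolliderLink c m) G.Joins

theorem connects_iff_walk :
    G.Connects c m a b ↔ Walk (G.NoncolliderLink c m) (G.ColliderWalk c) a b :=
  Walk.sup_iff

theorem ColliderWalk.connects (h : G.ColliderWalk c a b) : G.Connects c m a b :=
  connects_iff_walk.2 (.single h)

theorem Connects.trans {p q : EdgeEnd V} (h : G.Connects c m a p) (hpq : G.NoncolliderLink c m p q)
    (h' : G.Connects c m q b) : G.Connects c m a b :=
  Walk.trans h (.inr hpq) h'

theorem ColliderLink.symm : G.ColliderLink c a b → G.ColliderLink c b a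
  | mk hx => mk hx

theorem NoncolliderLink.symm : G.NoncolliderLink c m a b → G.NoncolliderLink c m b a
  | tails hx => tails hx
  | up hx => down hx
  | down hx => up hx

theorem ColliderWalk.symm (hG : IsSummaryGraph G) (h : G.ColliderWalk c a b) :
    G.ColliderWalk c b a :=
  Walk.symm (fun _ _ => ColliderLink.symm) (fun _ _ => joins_symm hG) h

theorem Connects.symm (hG : IsSummaryGraph G) (h : G.Connects c m a b) : G.Connects c m b a :=
  Walk.symm (fun _ _ => Or.imp .symm .symm) (fun _ _ => joins_symm hG) h

theorem colliderWalk_iff_tail : G.ColliderWalk c a b ↔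
    G.Joins a b ∨ ∃ x ∈ G.rSet c, G.ColliderWalk c a (head x) ∧ G.Joins (head x) b := by
  refine Walk.iff_tail.trans (or_congr_right ⟨?_, ?_⟩)
  · rintro ⟨_, _, h, ⟨hx⟩, hR⟩
    exact ⟨_, hx, h, hR⟩
  · rintro ⟨x, hx, h, hR⟩
    exact ⟨_, _, h, ⟨hx⟩, hR⟩

end Connects

/-! ### The node sets of a reduction -/

end EdgeMatrices

theorem mem_foster {V : Type*} {X : Matrix V V ℝ} {s c : Finset V} {j : V} :
    j ∈ foster X s c ↔ j ∈ s ∧ j ∉ c ∧ ∃ i ∈ c, IsAncestor X s i j := by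
  classical
  exact Finset.mem_filter

theorem mem_union_foster {V : Type*} [DecidableEq V] {X : Matrix V V ℝ} {s c : Finset V} {j : V} :
    j ∈ c ∪ foster X s c ↔
      ∃ i ∈ c, Relation.ReflTransGen (fun i k => i ∈ s ∧ k ∈ s ∧ i ≠ k ∧ X i k ≠ 0) i j := by
  simp only [Finset.mem_union, mem_foster, IsAncestor, Relation.reflTransGen_iff_eq_or_transGen]
  constructor
  · rintro (h | ⟨-, -, i, hi, h⟩)
    exacts [⟨j, h, .inl rfl⟩, ⟨i, hi, .inr h⟩]
  · rintro ⟨i, hi, rfl | h⟩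
    · exact .inl hi
    · obtain ⟨_, -, -, hj, -⟩ := Relation.TransGen.tail'_iff.1 h
      exact or_iff_not_imp_left.2 fun hjc => ⟨hj, hjc, i, hi, h⟩

namespace EdgeMatrices

section NodeSets

variable {V : Type*} [LinearOrder V] {G : EdgeMatrices V} {c m : Finset V} {i j : V}

theorem rSet_subset : G.rSet c ⊆ G.u :=
  Finset.union_subset Finset.inter_subset_right fun _ h => (mem_foster.1 h).1

theorem mem_rSet_of_mem (hc : j ∈ c) (hu : j ∈ G.u) : j ∈ G.rSet c :=
  Finset.mem_union_left _ (Finset.mem_inter.2 ⟨hc, hu⟩)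

theorem mem_rSet_of_dir (hi : i ∈ G.rSet c) (hj : j ∈ G.u) (hij : G.dir i j ≠ 0) :
    j ∈ G.rSet c := by
  by_cases h : i = j
  · exact h ▸ hi
  · obtain ⟨x, hx, hxi⟩ := mem_union_foster.1 hi
    exact mem_union_foster.2 ⟨x, hx, hxi.tail ⟨rSet_subset hi, hj, h, hij⟩⟩

@[elab_as_elim]
theorem rSet_induction {P : V → Prop} (base : ∀ i ∈ c, i ∈ G.u → P i)
    (step : ∀ i j, P i → j ∈ G.u → G.dir i j ≠ 0 → P j) (hj : j ∈ G.rSet c) : P j := by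
  obtain ⟨i, hi, h⟩ := mem_union_foster.1 hj
  clear hj
  induction h with
  | refl => exact base i (Finset.mem_inter.1 hi).1 (Finset.mem_inter.1 hi).2
  | tail _ hxy ih => exact step _ _ ih hxy.2.1 hxy.2.2.2

theorem mem_oSet : i ∈ G.oSet c ↔ i ∈ G.u ∧ i ∉ G.rSet c := Finset.mem_sdiff

theorem mem_psiSet : i ∈ G.psiSet c ↔ i ∈ G.rSet c ∨ i ∈ G.v := Finset.mem_union

theorem mem_phiSet : i ∈ G.phiSet c ↔ i ∈ G.psiSet c ∧ i ∉ c := Finset.mem_sdiff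

theorem mem_hSet : i ∈ G.hSet c m ↔ i ∈ G.oSet c ∧ i ∈ m := Finset.mem_inter

theorem mem_lSet : i ∈ G.lSet c m ↔ i ∈ G.phiSet c ∧ i ∈ m := Finset.mem_inter

theorem mem_uSet : i ∈ G.uSet c m ↔ i ∈ G.oSet c ∧ i ∉ m := by
  simp only [uSet, hSet, Finset.sdiff_inter_self_left, Finset.mem_sdiff]

theorem mem_vSet : i ∈ G.vSet c m ↔ i ∈ G.phiSet c ∧ i ∉ m := by
  simp only [vSet, lSet, Finset.sdiff_inter_self_left, Finset.mem_sdiff]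

theorem mem_nodes : i ∈ G.nodes ↔ i ∈ G.u ∨ i ∈ G.v := Finset.mem_union

theorem disjoint_oSet_psiSet (hG : IsSummaryGraph G) : Disjoint (G.oSet c) (G.psiSet c) := by
  refine Finset.disjoint_left.2 fun i ho hpsi => ?_
  obtain ⟨hu, hr⟩ := mem_oSet.1 ho
  exact (mem_psiSet.1 hpsi).elim hr (Finset.disjoint_left.1 hG.disjoint hu)

theorem notMem_phiSet_of_mem_oSet (hG : IsSummaryGraph G) (hi : i ∈ G.oSet c) : i ∉ G.phiSet c :=
  fun h => Finset.disjoint_left.1 (disjoint_oSet_psiSet hG) hi (mem_phiSet.1 h).1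

theorem mem_oSet_or_mem_phiSet : i ∈ G.oSet c ∨ i ∈ G.phiSet c ↔ i ∈ G.nodes \ c := by
  have := @mem_rSet_of_mem V _ G c i
  have := @rSet_subset V _ G c i
  simp only [mem_oSet, mem_phiSet, mem_psiSet, mem_nodes, Finset.mem_sdiff]
  tauto

theorem mem_hSet_union_lSet :
    i ∈ G.hSet c m ∪ G.lSet c m ↔ i ∈ G.nodes \ c ∧ i ∈ m := by
  rw [Finset.mem_union, mem_hSet, mem_lSet, ← or_and_right, mem_oSet_or_mem_phiSet]

theorem mem_uSet_union_vSet :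
    i ∈ G.uSet c m ∪ G.vSet c m ↔ i ∈ G.nodes \ c ∧ i ∉ m := by
  rw [Finset.mem_union, mem_uSet, mem_vSet, ← or_and_right, mem_oSet_or_mem_phiSet]

end NodeSets

open EdgeEnd

/-! ### Edge matrices as connecting walks -/

section ColliderWalk

variable {V : Type*} [LinearOrder V] {G : EdgeMatrices V} {c m : Finset V} {a b : EdgeEnd V}
  {i k : V}

theorem colliderWalk_tail_tail_self (hG : IsSummaryGraph G) (hi : i ∈ G.psiSet c) :
    G.ColliderWalk c (tail i) (tail i) := by
  rcases mem_psiSet.1 hi with hi | hi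
  · have loop := joins_head_tail_self hG (rSet_subset hi)
    exact (Walk.single (joins_symm hG loop)).snoc (.mk hi) loop
  · exact .single (show G.full i i ≠ 0 by simp [hG.full_diag i hi])

/-- An arrow with a tail in `o` cannot have its head in `r`, since `r` is closed under taking
parents. -/
theorem eq_head_of_colliderWalk_tail (hG : IsSummaryGraph G) (hk : k ∈ G.oSet c)
    (h : G.ColliderWalk c a (tail k)) : ∃ i, a = head i ∧ G.dir i k ≠ 0 := by
  obtain ⟨hku, hkr⟩ := mem_oSet.1 hk
  rcases colliderWalk_iff_tail.1 h with h | ⟨x, hx, -, h⟩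
  · cases a with
    | head i => exact ⟨i, rfl, h⟩
    | tail i =>
      exact absurd hku (Finset.disjoint_right.1 hG.disjoint (hG.full_supp i k h).2)
  · exact absurd (mem_rSet_of_dir hx hku h) hkr

theorem eq_head_of_connects_tail (hG : IsSummaryGraph G) (hk : k ∈ G.oSet c)
    (h : G.Connects c m a (tail k)) :
    ∃ i, a = head i ∧ Relation.ReflTransGen (fun x y => G.dir x y ≠ 0 ∧ y ∈ G.u) i k := by
  replace h := connects_iff_walk.1 (h.symm hG)
  have hku := (mem_oSet.1 hk).1
  induction h with
  | single h =>
    obtain ⟨i, rfl, hik⟩ := eq_head_of_colliderWalk_tail hG hk (h.symm hG)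
    exact ⟨i, rfl, .single ⟨hik, hku⟩⟩
  | snoc _ hpq hqb ih =>
    obtain ⟨y, rfl, hyk⟩ := ih
    obtain - | hy := hpq
    have hyo := (mem_hSet.1 hy).1
    obtain ⟨i, rfl, hiy⟩ := eq_head_of_colliderWalk_tail hG hyo (hqb.symm hG)
    exact ⟨i, rfl, .head ⟨hiy, (mem_oSet.1 hyo).1⟩ hyk⟩

theorem le_of_connects_head_tail (hG : IsSummaryGraph G) (hk : k ∈ G.oSet c)
    (h : G.Connects c m (head i) (tail k)) : i ≤ k := by
  obtain ⟨_, ⟨⟩, path⟩ := eq_head_of_connects_tail hG hk h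
  clear h hk
  induction path with
  | refl => exact le_rfl
  | @tail x y _ hxy ih =>
    exact ih.trans (not_lt.1 fun hlt =>
      hxy.1 (hG.dir_upper x (hG.dir_supp x y hxy.1).1 y hxy.2 hlt))

theorem not_connects_tail_tail (hG : IsSummaryGraph G) (hk : k ∈ G.oSet c) :
    ¬ G.Connects c m (tail i) (tail k) := fun h => by
  obtain ⟨_, h, -⟩ := eq_head_of_connects_tail hG hk h
  cases h

/-- The end at `i` of the edges recorded in row `i` of the block triangular matrix. -/
noncomputable def rowEnd (G : EdgeMatrices V) (c : Finset V) (i : V) : EdgeEnd V :=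
  if i ∈ G.oSet c then head i else tail i

theorem rowEnd_of_mem_oSet (hi : i ∈ G.oSet c) : G.rowEnd c i = head i := if_pos hi

theorem rowEnd_of_mem_phiSet (hG : IsSummaryGraph G) (hi : i ∈ G.phiSet c) :
    G.rowEnd c i = tail i :=
  if_neg fun ho => notMem_phiSet_of_mem_oSet hG ho hi

theorem colliderWalk_rowEnd_tail_self (hG : IsSummaryGraph G) (hi : i ∈ G.nodes \ c) :
    G.ColliderWalk c (G.rowEnd c i) (tail i) := by
  rcases mem_oSet_or_mem_phiSet.2 hi with hi | hi
  · rw [rowEnd_of_mem_oSet hi]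
    exact .single (joins_head_tail_self hG (mem_oSet.1 hi).1)
  · rw [rowEnd_of_mem_phiSet hG hi]
    exact colliderWalk_tail_tail_self hG (mem_phiSet.1 hi).1

theorem noncolliderLink_rowEnd (hG : IsSummaryGraph G) (hi : i ∈ G.hSet c m ∪ G.lSet c m) :
    G.NoncolliderLink c m (tail i) (G.rowEnd c i) := by
  rcases Finset.mem_union.1 hi with h | h
  · exact rowEnd_of_mem_oSet (mem_hSet.1 h).1 ▸ .down h
  · exact rowEnd_of_mem_phiSet hG (mem_lSet.1 h).1 ▸ .tails hi

/-- A tail at a node of `h` cannot be joined to another tail, by `not_connects_tail_tail`. -/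
theorem exists_eq_rowEnd_of_noncolliderLink (hG : IsSummaryGraph G)
    (hab : G.NoncolliderLink c m a b) (h : G.ColliderWalk c b (tail k)) :
    ∃ x ∈ G.hSet c m ∪ G.lSet c m, a = tail x ∧ b = G.rowEnd c x := by
  have notMem_hSet {x} (h : G.ColliderWalk c (tail x) (tail k)) : x ∉ G.hSet c m := fun hx =>
    not_connects_tail_tail (m := m) hG (mem_hSet.1 hx).1 (h.symm hG).connects
  cases hab with
  | @tails x hx =>
    have hl := (Finset.mem_union.1 hx).resolve_left (notMem_hSet h)
    exact ⟨x, hx, rfl, (rowEnd_of_mem_phiSet hG (mem_lSet.1 hl).1).symm⟩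
  | up hx => exact absurd hx (notMem_hSet h)
  | @down x hx =>
    exact ⟨x, Finset.mem_union_left _ hx, rfl, (rowEnd_of_mem_oSet (mem_hSet.1 hx).1).symm⟩

end ColliderWalk

section Supports

variable {V : Type*} [Fintype V] [LinearOrder V] {G : EdgeMatrices V} {c m : Finset V}
  {i j k : V}

theorem isBinary_Q : IsBinary (G.Q c) := isBinary_zer _ _

theorem isBinary_Cmat : IsBinary (G.Cmat c) := isBinary_ind _

theorem isBinary_Spsi : IsBinary (G.Spsi c) := isBinary_ind _

theorem isBinary_K : IsBinary (G.K c m) := isBinary_zer _ _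

theorem isBinary_Z : IsBinary (G.Z c m) := isBinary_zer _ _

instance : NonnegEntries (G.Q c) := isBinary_Q.nonnegEntries

instance : NonnegEntries (G.Cmat c) := isBinary_Cmat.nonnegEntries

instance : NonnegEntries (G.Spsi c) := isBinary_Spsi.nonnegEntries

instance : NonnegEntries (G.K c m) := isBinary_K.nonnegEntries

instance : NonnegEntries (G.Z c m) := isBinary_Z.nonnegEntries

theorem Q_ne_zero (hG : IsSummaryGraph G) :
    G.Q c i j ≠ 0 ↔ G.ColliderWalk c (head i) (head j) := by
  rw [Q, zer_ne_zero hG.dash_binary]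
  constructor
  · rintro (⟨hi, rfl⟩ | h)
    · exact .single (joins_head_head_self hG (rSet_subset hi))
    · induction h with
      | single h => exact .single h
      | snoc _ hpq hqb ih =>
        obtain ⟨hp, rfl⟩ := hpq
        exact ih.snoc (.mk hp) hqb
  · intro h
    generalize hb : head j = b at h
    refine .inr ?_
    induction h generalizing j with
    | single h => subst hb; exact .single h
    | snoc _ hpq hqb ih =>
      subst hb
      obtain ⟨hx⟩ := hpq
      exact (ih rfl).snoc ⟨hx, rfl⟩ hqb

theorem colliderWalk_head_tail (hG : IsSummaryGraph G) : G.ColliderWalk c (head i) (tail k) ↔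
    G.dir i k ≠ 0 ∨ ∃ x ∈ G.rSet c, G.Q c i x ≠ 0 ∧ G.dir x k ≠ 0 := by
  rw [colliderWalk_iff_tail]
  simp only [Q_ne_zero hG, Joins]

theorem colliderWalk_tail_tail (hG : IsSummaryGraph G) : G.ColliderWalk c (tail i) (tail k) ↔
    G.full i k ≠ 0 ∨ ∃ x ∈ G.rSet c, ∃ y ∈ G.rSet c,
      G.dir x i ≠ 0 ∧ G.Q c x y ≠ 0 ∧ G.dir y k ≠ 0 := by
  have comm {y} : G.ColliderWalk c (tail i) (head y) ↔ G.ColliderWalk c (head y) (tail i) :=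
    ⟨.symm hG, .symm hG⟩
  have Q_symm {x y} : G.Q c x y ≠ 0 ↔ G.Q c y x ≠ 0 := by
    simp only [Q_ne_zero hG]
    exact ⟨.symm hG, .symm hG⟩
  have Q_self {y} (hy : y ∈ G.rSet c) : G.Q c y y ≠ 0 :=
    (Q_ne_zero hG).2 (.single (joins_head_head_self hG (rSet_subset hy)))
  rw [colliderWalk_iff_tail]
  simp only [Joins, comm, colliderWalk_head_tail hG]
  grind

theorem Cmat_ne_zero (hG : IsSummaryGraph G) (hi : i ∈ G.oSet c) (hk : k ∈ G.psiSet c) :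
    G.Cmat c i k ≠ 0 ↔ G.ColliderWalk c (head i) (tail k) := by
  have : NonnegEntries G.dir := IsBinary.nonnegEntries hG.dir_binary
  simp only [Cmat, ind_ne_zero, add_ne_zero, mul_ne_zero, blk_ne_zero, colliderWalk_head_tail hG,
    hi, hk, true_and]
  grind

theorem Spsi_ne_zero (hG : IsSummaryGraph G) (hi : i ∈ G.psiSet c) (hk : k ∈ G.psiSet c) :
    G.Spsi c i k ≠ 0 ↔ G.ColliderWalk c (tail i) (tail k) := by
  have : NonnegEntries G.dir := IsBinary.nonnegEntries hG.dir_binary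
  have : NonnegEntries G.full := IsBinary.nonnegEntries hG.full_binary
  simp only [Spsi, ind_ne_zero, add_ne_zero, mul_ne_zero, Matrix.transpose_apply, blk_ne_zero,
    colliderWalk_tail_tail hG, hi, hk, true_and]
  grind

/-- The block triangular matrix whose partial closure is `K`. -/
noncomputable def triangular (G : EdgeMatrices V) (c : Finset V) : Matrix V V ℝ :=
  blk (G.oSet c) (G.oSet c) G.dir + blk (G.oSet c) (G.phiSet c) (G.Cmat c)
    + blk (G.phiSet c) (G.phiSet c) (G.Spsi c)

theorem isBinary_triangular (hG : IsSummaryGraph G) : IsBinary (G.triangular c) := by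
  have disj {i} : i ∈ G.oSet c → i ∉ G.phiSet c := notMem_phiSet_of_mem_oSet hG
  refine .add (.add (.blk hG.dir_binary _ _) (isBinary_Cmat.blk _ _) ?_)
    (isBinary_Spsi.blk _ _) ?_
  · intro i j h
    obtain ⟨-, hj, -⟩ := blk_ne_zero.1 h
    simp [blk, disj hj]
  · intro i j h
    have hi : i ∈ G.oSet c := by
      by_contra hi
      simp [blk, hi] at h
    simp [blk, disj hi]

theorem triangular_ne_zero (hG : IsSummaryGraph G) : G.triangular c i k ≠ 0 ↔
    i ∈ G.nodes \ c ∧ k ∈ G.nodes \ c ∧ G.ColliderWalk c (G.rowEnd c i) (tail k) := by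
  have : NonnegEntries G.dir := IsBinary.nonnegEntries hG.dir_binary
  simp only [← mem_oSet_or_mem_phiSet, triangular, add_ne_zero, blk_ne_zero]
  have disj {i} : i ∈ G.oSet c → i ∉ G.phiSet c := notMem_phiSet_of_mem_oSet hG
  have from_o (hk : k ∈ G.oSet c) {a} := eq_head_of_colliderWalk_tail hG hk (a := a)
  have phi_psi {i} (hi : i ∈ G.phiSet c) : i ∈ G.psiSet c := (mem_phiSet.1 hi).1
  by_cases hi : i ∈ G.oSet c
  · have hdir (h : G.dir i k ≠ 0) : G.ColliderWalk c (head i) (tail k) := .single h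
    have hC (hk : k ∈ G.phiSet c) := Cmat_ne_zero hG hi (phi_psi hk)
    rw [rowEnd_of_mem_oSet hi]
    grind
  · by_cases hi' : i ∈ G.phiSet c
    · have hS (hk : k ∈ G.phiSet c) := Spsi_ne_zero hG (phi_psi hi') (phi_psi hk)
      rw [rowEnd_of_mem_phiSet hG hi']
      grind
    · simp [hi, hi']

theorem walk_triangular_iff_connects (hG : IsSummaryGraph G) (hi : i ∈ G.nodes \ c)
    (hk : k ∈ G.nodes \ c) :
    Walk (Pass (G.hSet c m ∪ G.lSet c m)) (fun p q => G.triangular c p q ≠ 0) i k ↔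
      G.Connects c m (G.rowEnd c i) (tail k) := by
  constructor
  · intro h
    clear hk
    induction h with
    | single h => exact ((triangular_ne_zero hG).1 h).2.2.connects
    | snoc _ hpq hqb ih =>
      obtain ⟨hp, rfl⟩ := hpq
      exact ih.trans (noncolliderLink_rowEnd hG hp) ((triangular_ne_zero hG).1 hqb).2.2.connects
  · intro h
    generalize hb : tail k = b at h
    replace h := connects_iff_walk.1 h
    induction h generalizing k with
    | single h => subst hb; exact .single ((triangular_ne_zero hG).2 ⟨hi, hk, h⟩)
    | snoc _ hpq hqb ih =>
      obtain ⟨x, hx, rfl, rfl⟩ := exists_eq_rowEnd_of_noncolliderLink hG hpq (hb ▸ hqb)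
      have hx' := (mem_hSet_union_lSet.1 hx).1
      exact (ih hx' rfl).snoc ⟨hx, rfl⟩ ((triangular_ne_zero hG).2 ⟨hx', hk, hb ▸ hqb⟩)

theorem K_ne_zero (hG : IsSummaryGraph G) (hi : i ∈ G.nodes \ c) (hk : k ∈ G.nodes \ c) :
    G.K c m i k ≠ 0 ↔ G.Connects c m (G.rowEnd c i) (tail k) := by
  refine (zer_ne_zero (isBinary_triangular hG)).trans
    (Iff.trans ?_ (walk_triangular_iff_connects hG hi hk))
  refine or_iff_right_of_imp ?_
  rintro ⟨-, rfl⟩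
  exact .single ((triangular_ne_zero hG).2 ⟨hi, hi, colliderWalk_rowEnd_tail_self hG hi⟩)

theorem triangular_of_mem_phiSet (hG : IsSummaryGraph G) (hi : i ∈ G.phiSet c) :
    G.triangular c i k = blk (G.phiSet c) (G.phiSet c) (G.Spsi c) i k := by
  have : i ∉ G.oSet c := fun ho => notMem_phiSet_of_mem_oSet hG ho hi
  simp [triangular, blk, this]

theorem walk_triangular_iff_of_mem_phiSet (hG : IsSummaryGraph G) (hi : i ∈ G.phiSet c) :
    Walk (Pass (G.hSet c m ∪ G.lSet c m)) (fun p q => G.triangular c p q ≠ 0) i k ↔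
      Walk (Pass (G.lSet c m))
        (fun p q => blk (G.phiSet c) (G.phiSet c) (G.Spsi c) p q ≠ 0) i k := by
  constructor
  · intro h
    induction h with
    | single h => exact .single (triangular_of_mem_phiSet hG hi ▸ h)
    | @snoc x _ _ _ hpq hqb ih =>
      obtain ⟨hx, rfl⟩ := hpq
      have hxphi : x ∈ G.phiSet c := by
        rcases ih with h | ⟨-, -, h⟩ <;> exact (blk_ne_zero.1 h).2.1
      have hxl := (Finset.mem_union.1 hx).resolve_left fun hxh =>
        notMem_phiSet_of_mem_oSet hG (mem_hSet.1 hxh).1 hxphi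
      exact ih.snoc ⟨hxl, rfl⟩ (triangular_of_mem_phiSet hG hxphi ▸ hqb)
  · have triangular_of_blk {p q}
        (h : blk (G.phiSet c) (G.phiSet c) (G.Spsi c) p q ≠ 0) : G.triangular c p q ≠ 0 :=
      triangular_of_mem_phiSet hG (blk_ne_zero.1 h).1 ▸ h
    exact Walk.flatten (fun h hpq h' => h.trans ⟨Finset.mem_union_right _ hpq.1, hpq.2⟩ h')
      fun h => .single (triangular_of_blk h)

theorem Z_ne_zero (hG : IsSummaryGraph G) (hi : i ∈ G.phiSet c) (hk : k ∈ G.phiSet c) :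
    G.Z c m i k ≠ 0 ↔ G.Connects c m (tail i) (tail k) := by
  have hi' := mem_oSet_or_mem_phiSet.1 (.inr hi)
  rw [← rowEnd_of_mem_phiSet hG hi,
    ← walk_triangular_iff_connects hG hi' (mem_oSet_or_mem_phiSet.1 (.inr hk)),
    walk_triangular_iff_of_mem_phiSet hG hi, Z, zer_ne_zero (isBinary_Spsi.blk _ _)]
  refine or_iff_right_of_imp ?_
  rintro ⟨-, rfl⟩
  have hpsi := (mem_phiSet.1 hi).1
  exact .single (blk_ne_zero.2
    ⟨hi, hi, (Spsi_ne_zero hG hpsi hpsi).2 (colliderWalk_tail_tail_self hG hpsi)⟩)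

end Supports

/-! ### The reduction of a summary graph -/

section HeadHead

variable {V : Type*} [LinearOrder V] {G : EdgeMatrices V} {c m : Finset V} {i j : V}

theorem mem_nodes_sdiff_of_mem_oSet (hi : i ∈ G.oSet c) : i ∈ G.nodes \ c :=
  mem_oSet_or_mem_phiSet.1 (.inl hi)

/-- Where a connecting walk between two heads leaves `h` or `l` for the last time, it can be
completed to the end `head j`. -/
theorem exists_of_connects_head_head (hG : IsSummaryGraph G)
    (h : G.Connects c m (head i) (head j)) :
    (∃ x y, (x = i ∨ x ∈ G.hSet c m ∧ G.Connects c m (head i) (tail x)) ∧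
        G.ColliderWalk c (head x) (head y) ∧
        (y = j ∨ y ∈ G.hSet c m ∧ G.Connects c m (head j) (tail y))) ∨
      ∃ x ∈ G.lSet c m, ∃ y ∈ G.lSet c m, G.Connects c m (head i) (tail x) ∧
        G.Connects c m (tail x) (tail y) ∧ G.Connects c m (head j) (tail y) := by
  generalize hb : head j = b at h
  replace h := connects_iff_walk.1 h
  induction h generalizing j with
  | single h => subst hb; exact .inl ⟨i, j, .inl rfl, h, .inl rfl⟩
  | snoc h hpq hqb ih =>
    subst hb
    replace h := connects_iff_walk.2 h
    replace hqb : G.ColliderWalk c _ _ := hqb.symm hG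
    cases hpq with
    | @tails x hx =>
      rcases Finset.mem_union.1 hx with hx | hx
      · have loop := joins_head_head_self hG (mem_oSet.1 (mem_hSet.1 hx).1).1
        exact .inl ⟨x, x, .inr ⟨hx, h⟩, .single loop, .inr ⟨hx, hqb.connects⟩⟩
      · exact .inr ⟨x, hx, x, hx, h, (colliderWalk_tail_tail_self hG
          (mem_phiSet.1 (mem_lSet.1 hx).1).1).connects, hqb.connects⟩
    | @up x hx =>
      have to_j {y} (h : G.Connects c m (head x) (tail y)) : G.Connects c m (head j) (tail y) :=
        hqb.connects.trans (.down hx) h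
      rcases ih rfl with ⟨y, z, hy, hyz, rfl | ⟨hz, hxz⟩⟩ | ⟨y, hy, z, hz, hiy, hyz, hxz⟩
      exacts [.inl ⟨y, z, hy, hyz, .inr ⟨hx, hqb.connects⟩⟩,
        .inl ⟨y, z, hy, hyz, .inr ⟨hz, to_j hxz⟩⟩, .inr ⟨y, hy, z, hz, hiy, hyz, to_j hxz⟩]
    | @down x hx => exact .inl ⟨x, j, .inr ⟨hx, h⟩, hqb.symm hG, .inl rfl⟩

theorem connects_head_head_iff (hG : IsSummaryGraph G) : G.Connects c m (head i) (head j) ↔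
    (∃ x y, (x = i ∨ x ∈ G.hSet c m ∧ G.Connects c m (head i) (tail x)) ∧
        G.ColliderWalk c (head x) (head y) ∧
        (y = j ∨ y ∈ G.hSet c m ∧ G.Connects c m (head j) (tail y))) ∨
      ∃ x ∈ G.lSet c m, ∃ y ∈ G.lSet c m, G.Connects c m (head i) (tail x) ∧
        G.Connects c m (tail x) (tail y) ∧ G.Connects c m (head j) (tail y) := by
  refine ⟨exists_of_connects_head_head hG, ?_⟩
  rintro (⟨x, y, hx, hxy, hy⟩ | ⟨x, hx, y, hy, hix, hxy, hjy⟩)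
  · have hiy : G.Connects c m (head i) (head y) := by
      rcases hx with rfl | ⟨hx, hix⟩
      exacts [hxy.connects, hix.trans (.down hx) hxy.connects]
    rcases hy with rfl | ⟨hy, hjy⟩
    exacts [hiy, hiy.trans (.up hy) (hjy.symm hG)]
  · exact hix.trans (.tails (Finset.mem_union_right _ hx))
      (hxy.trans (.tails (Finset.mem_union_right _ hy)) (hjy.symm hG))

end HeadHead

section Reduce

variable {V : Type*} [Fintype V] [LinearOrder V] {G : EdgeMatrices V} {c m : Finset V}
  {i j k : V}

theorem nodes_reduce : (G.reduce c m).nodes = G.nodes \ (c ∪ m) := by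
  ext i
  exact mem_uSet_union_vSet.trans (by simp only [Finset.mem_sdiff, Finset.mem_union]; tauto)

theorem K_ne_zero_of_mem_uSet (hG : IsSummaryGraph G) (hi : i ∈ G.uSet c m)
    (hk : k ∈ G.nodes \ c) : G.K c m i k ≠ 0 ↔ G.Connects c m (head i) (tail k) := by
  have hio := (mem_uSet.1 hi).1
  rw [K_ne_zero hG (mem_nodes_sdiff_of_mem_oSet hio) hk, rowEnd_of_mem_oSet hio]

theorem reduce_dir_ne_zero (hG : IsSummaryGraph G) : (G.reduce c m).dir i k ≠ 0 ↔
    i ∈ G.uSet c m ∧ k ∈ G.uSet c m ∪ G.vSet c m ∧ G.Connects c m (head i) (tail k) := by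
  simp only [reduce, add_ne_zero, blk_ne_zero, ← and_or_left, ← or_and_right, ← Finset.mem_union]
  exact and_congr_right fun hi => and_congr_right fun hk =>
    K_ne_zero_of_mem_uSet hG hi (mem_uSet_union_vSet.1 hk).1

theorem reduce_full_ne_zero (hG : IsSummaryGraph G) : (G.reduce c m).full i k ≠ 0 ↔
    i ∈ G.vSet c m ∧ k ∈ G.vSet c m ∧ G.Connects c m (tail i) (tail k) :=
  blk_ne_zero.trans <| and_congr_right fun hi => and_congr_right fun hk =>
    Z_ne_zero hG (mem_vSet.1 hi).1 (mem_vSet.1 hk).1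

theorem reduce_dash_ne_zero (hG : IsSummaryGraph G) : (G.reduce c m).dash i j ≠ 0 ↔
    i ∈ G.uSet c m ∧ j ∈ G.uSet c m ∧ G.Connects c m (head i) (head j) := by
  have K_iff {i k} (hi : i ∈ G.uSet c m) (hk : k ∈ G.hSet c m ∪ G.lSet c m) :=
    K_ne_zero_of_mem_uSet hG hi (mem_hSet_union_lSet.1 hk).1
  have Z_iff {x y} (hx : x ∈ G.lSet c m) (hy : y ∈ G.lSet c m) :=
    Z_ne_zero (m := m) hG (mem_lSet.1 hx).1 (mem_lSet.1 hy).1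
  simp only [reduce, ind_ne_zero, add_ne_zero, mul_ne_zero, Matrix.transpose_apply, blk_ne_zero,
    Q_ne_zero hG, connects_head_head_iff hG, or_and_right, and_or_left, exists_or]
  grind

end Reduce

section Closure

variable {V : Type*} [Fintype V] [LinearOrder V] {G : EdgeMatrices V} {c m : Finset V}
  {a b : EdgeEnd V}

theorem joins_reduce (hG : IsSummaryGraph G) : (G.reduce c m).Joins a b ↔
    (G.reduce c m).IsEnd a ∧ (G.reduce c m).IsEnd b ∧ G.Connects c m a b := by
  cases a with
  | head i => cases b with
    | head j => exact reduce_dash_ne_zero hG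
    | tail k => exact reduce_dir_ne_zero hG
  | tail i => cases b with
    | head j =>
      refine (reduce_dir_ne_zero hG).trans (and_left_comm.trans ?_)
      exact and_congr_right' (and_congr_right' ⟨.symm hG, .symm hG⟩)
    | tail k =>
      have no_tail_in_o {x y} (hy : y ∈ G.uSet c m) : ¬ G.Connects c m (tail x) (tail y) :=
        not_connects_tail_tail hG (mem_uSet.1 hy).1
      have mem_v {x y} (h : G.Connects c m (tail x) (tail y)) :
          y ∈ (G.reduce c m).nodes ↔ y ∈ G.vSet c m :=
        mem_nodes.trans (or_iff_right fun hy => no_tail_in_o hy h)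
      refine (reduce_full_ne_zero hG).trans ?_
      constructor
      · exact fun ⟨hi, hk, h⟩ => ⟨(mem_v (h.symm hG)).2 hi, (mem_v h).2 hk, h⟩
      · exact fun ⟨hi, hk, h⟩ => ⟨(mem_v (h.symm hG)).1 hi, (mem_v h).1 hk, h⟩

theorem isBinary_reduce_dir (hG : IsSummaryGraph G) : IsBinary (G.reduce c m).dir := by
  refine .add (isBinary_K.blk _ _) (isBinary_K.blk _ _) fun i k h => ?_
  have hk : k ∉ G.vSet c m := fun hv =>
    notMem_phiSet_of_mem_oSet hG (mem_uSet.1 (blk_ne_zero.1 h).2.1).1 (mem_vSet.1 hv).1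
  simp [blk, hk]

theorem isSummaryGraph_reduce (hG : IsSummaryGraph G) (c m : Finset V) :
    IsSummaryGraph (G.reduce c m) := by
  have symm {a b} (h : (G.reduce c m).Joins a b) : (G.reduce c m).Joins b a :=
    let ⟨ha, hb, hab⟩ := (joins_reduce hG).1 h
    (joins_reduce hG).2 ⟨hb, ha, hab.symm hG⟩
  have hdir : IsBinary (G.reduce c m).dir := isBinary_reduce_dir hG
  have hdash : IsBinary (G.reduce c m).dash := isBinary_ind _
  have hfull : IsBinary (G.reduce c m).full := isBinary_Z.blk _ _
  exact
  { disjoint := (disjoint_oSet_psiSet hG).mono Finset.sdiff_subset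
      (Finset.sdiff_subset.trans Finset.sdiff_subset)
    dir_binary := hdir
    dash_binary := hdash
    full_binary := hfull
    dir_supp i k h := ((reduce_dir_ne_zero hG).1 h).imp_right And.left
    dash_supp i j h := ((reduce_dash_ne_zero hG).1 h).imp_right And.left
    full_supp i j h := ((reduce_full_ne_zero hG).1 h).imp_right And.left
    dir_diag i hi := hdir.eq_one <| (reduce_dir_ne_zero hG).2 ⟨hi, Finset.mem_union_left _ hi,
      .single (joins_head_tail_self hG (mem_oSet.1 (mem_uSet.1 hi).1).1)⟩
    dash_diag i hi := hdash.eq_one <| (reduce_dash_ne_zero hG).2 ⟨hi, hi,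
      .single (joins_head_head_self hG (mem_oSet.1 (mem_uSet.1 hi).1).1)⟩
    full_diag i hi := hfull.eq_one <| (reduce_full_ne_zero hG).2 ⟨hi, hi,
      (colliderWalk_tail_tail_self hG (mem_phiSet.1 (mem_vSet.1 hi).1).1).connects⟩
    dir_upper i _ k hk hki := by
      by_contra h
      exact hki.not_ge (le_of_connects_head_tail hG (mem_uSet.1 hk).1
        ((reduce_dir_ne_zero hG).1 h).2.2)
    dash_symm := hdash.apply_comm fun i j => symm (a := head i) (b := head j)
    full_symm := hfull.apply_comm fun i j => symm (a := tail i) (b := tail j) }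

end Closure

/-! ### Successive reductions -/

section Mono

variable {V : Type*} [LinearOrder V] {G : EdgeMatrices V} {c m c₁ c₂ m₁ m₂ : Finset V}
  {a b : EdgeEnd V} {x : V}

theorem rSet_mono (h : c₁ ⊆ c₂) : G.rSet c₁ ⊆ G.rSet c₂ := fun _ hj =>
  rSet_induction (fun _ hi => mem_rSet_of_mem (h hi)) (fun _ _ => mem_rSet_of_dir) hj

theorem oSet_anti (h : c₁ ⊆ c₂) : G.oSet c₂ ⊆ G.oSet c₁ :=
  Finset.sdiff_subset_sdiff subset_rfl (rSet_mono h)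

theorem mem_hSet_union_lSet_mono (hm : Disjoint m₁ c₂) (hx : x ∈ G.hSet c₁ m₁ ∪ G.lSet c₁ m₁) :
    x ∈ G.hSet (c₁ ∪ c₂) (m₁ ∪ m₂) ∪ G.lSet (c₁ ∪ c₂) (m₁ ∪ m₂) := by
  have hxc₂ := @Finset.disjoint_left.1 hm x
  rw [mem_hSet_union_lSet] at hx ⊢
  grind

/-- At a node of `r` the walk turns around at the loop of that node. -/
theorem Connects.trans_head_tail (hG : IsSummaryGraph G) (hu : x ∈ G.u)
    (hx : x ∈ G.hSet c m ∪ G.lSet c m) (h : G.Connects c m a (head x))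
    (h' : G.Connects c m (tail x) b) : G.Connects c m a b := by
  by_cases hr : x ∈ G.rSet c
  · exact Connects.trans (Walk.snoc h (.inl ⟨hr⟩) (joins_head_tail_self hG hu)) (.tails hx) h'
  · have ho : x ∈ G.oSet c := mem_oSet.2 ⟨hu, hr⟩
    exact h.trans (.up (mem_hSet.2 ⟨ho, (mem_hSet_union_lSet.1 hx).2⟩)) h'

theorem Connects.mono (hG : IsSummaryGraph G) (hm : Disjoint m₁ c₂) (h : G.Connects c₁ m₁ a b) :
    G.Connects (c₁ ∪ c₂) (m₁ ∪ m₂) a b := by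
  have marg {x} (hx : x ∈ G.hSet c₁ m₁) := Finset.mem_union_left (G.lSet c₁ m₁) hx
  have mem_u {x} (hx : x ∈ G.hSet c₁ m₁) := (mem_oSet.1 (mem_hSet.1 hx).1).1
  refine Walk.flatten (fun {a p q b} h hpq h' => ?_) .single h
  rcases hpq with hpq | hpq
  · obtain ⟨hx⟩ := hpq
    exact Walk.trans h (.inl ⟨rSet_mono Finset.subset_union_left hx⟩) h'
  cases hpq with
  | tails hx => exact Connects.trans h (.tails (mem_hSet_union_lSet_mono hm hx)) h'
  | up hx =>
    exact Connects.trans_head_tail hG (mem_u hx) (mem_hSet_union_lSet_mono hm (marg hx)) h h'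
  | down hx =>
    exact Connects.symm hG <| Connects.trans_head_tail hG (mem_u hx)
      (mem_hSet_union_lSet_mono hm (marg hx)) (Connects.symm hG h') (Connects.symm hG h)

end Mono

section Successive

variable {V : Type*} [Fintype V] [LinearOrder V] {G : EdgeMatrices V} {c₁ c₂ m₁ m₂ : Finset V}
  {a b : EdgeEnd V} {j x : V}

theorem mem_rSet_union_of_mem_rSet_reduce (hG : IsSummaryGraph G)
    (hj : j ∈ (G.reduce c₁ m₁).rSet c₂) : j ∈ G.rSet (c₁ ∪ c₂) := by
  refine rSet_induction (fun i hi hu => ?_) (fun i j hi hju hij => ?_) hj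
  · exact mem_rSet_of_mem (Finset.mem_union_right _ hi) (mem_oSet.1 (mem_uSet.1 hu).1).1
  · obtain ⟨_, ⟨⟩, path⟩ := eq_head_of_connects_tail hG (mem_uSet.1 hju).1
      ((reduce_dir_ne_zero hG).1 hij).2.2
    clear hij hju hj
    induction path with
    | refl => exact hi
    | tail _ hxy ih => exact mem_rSet_of_dir ih hxy.2 hxy.1

/-- On a directed path from `j` to a node of `c₂`, let `s` be the first node which survives the
first reduction: marginalising over the nodes before it shrinks that part of the path to an
arrow. -/
theorem exists_mem_rSet_reduce (hG : IsSummaryGraph G) (hm : Disjoint m₁ c₂)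
    (hj : j ∈ G.rSet (c₁ ∪ c₂)) (hj₁ : j ∉ G.rSet c₁) :
    ∃ s ∈ (G.reduce c₁ m₁).rSet c₂,
      s = j ∨ j ∈ G.hSet c₁ m₁ ∧ G.Connects c₁ m₁ (head s) (tail j) := by
  revert hj₁
  refine rSet_induction (fun i hi hu hi₁ => ?_) (fun i j ih hu hij hj₁ => ?_) hj
  · have hi₂ : i ∈ c₂ :=
      (Finset.mem_union.1 hi).resolve_left fun hi => hi₁ (mem_rSet_of_mem hi hu)
    have hiu : i ∈ G.uSet c₁ m₁ :=
      mem_uSet.2 ⟨mem_oSet.2 ⟨hu, hi₁⟩, Finset.disjoint_right.1 hm hi₂⟩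
    exact ⟨i, mem_rSet_of_mem hi₂ hiu, .inl rfl⟩
  · obtain ⟨s, hs, hsi⟩ := ih fun hi => hj₁ (mem_rSet_of_dir hi hu hij)
    have hsj : G.Connects c₁ m₁ (head s) (tail j) := by
      have hij : G.Connects c₁ m₁ (head i) (tail j) := .single hij
      rcases hsi with rfl | ⟨hi, hsi⟩
      exacts [hij, hsi.trans (.down hi) hij]
    have hjo : j ∈ G.oSet c₁ := mem_oSet.2 ⟨hu, hj₁⟩
    by_cases hjm : j ∈ m₁
    · exact ⟨s, hs, .inr ⟨mem_hSet.2 ⟨hjo, hjm⟩, hsj⟩⟩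
    · have hju : j ∈ G.uSet c₁ m₁ := mem_uSet.2 ⟨hjo, hjm⟩
      exact ⟨j, mem_rSet_of_dir hs hju ((reduce_dir_ne_zero hG).2
        ⟨rSet_subset hs, Finset.mem_union_left _ hju, hsj⟩), .inl rfl⟩

theorem mem_rSet_reduce (hG : IsSummaryGraph G) (hm : Disjoint m₁ c₂) :
    j ∈ (G.reduce c₁ m₁).rSet c₂ ↔ j ∈ G.uSet c₁ m₁ ∧ j ∈ G.rSet (c₁ ∪ c₂) := by
  refine ⟨fun hj => ⟨rSet_subset hj, mem_rSet_union_of_mem_rSet_reduce hG hj⟩, ?_⟩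
  rintro ⟨hju, hj⟩
  obtain ⟨hjo, hjm⟩ := mem_uSet.1 hju
  obtain ⟨s, hs, rfl | ⟨hjh, -⟩⟩ := exists_mem_rSet_reduce hG hm hj (mem_oSet.1 hjo).2
  exacts [hs, absurd (mem_hSet.1 hjh).2 hjm]

theorem mem_oSet_reduce (hG : IsSummaryGraph G) (hm : Disjoint m₁ c₂) :
    j ∈ (G.reduce c₁ m₁).oSet c₂ ↔ j ∈ G.oSet (c₁ ∪ c₂) ∧ j ∉ m₁ := by
  have mono := @rSet_mono V _ G c₁ (c₁ ∪ c₂) Finset.subset_union_left j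
  rw [mem_oSet, mem_rSet_reduce hG hm, show j ∈ (G.reduce c₁ m₁).u ↔ _ from mem_uSet, mem_uSet,
    mem_oSet, mem_oSet]
  tauto

theorem uSet_reduce (hG : IsSummaryGraph G) (hm : Disjoint m₁ c₂) :
    (G.reduce c₁ m₁).uSet c₂ m₂ = G.uSet (c₁ ∪ c₂) (m₁ ∪ m₂) := by
  ext j
  rw [mem_uSet, mem_oSet_reduce hG hm, mem_uSet, Finset.mem_union, not_or, and_assoc]

theorem mem_hSet_reduce (hG : IsSummaryGraph G) (hm : Disjoint m₁ c₂) :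
    j ∈ (G.reduce c₁ m₁).hSet c₂ m₂ ↔ j ∈ G.oSet (c₁ ∪ c₂) ∧ j ∈ m₂ ∧ j ∉ m₁ := by
  rw [mem_hSet, mem_oSet_reduce hG hm]
  tauto

theorem mem_hSet_or_mem_hSet_reduce (hG : IsSummaryGraph G) (hm : Disjoint m₁ c₂)
    (hx : x ∈ G.hSet (c₁ ∪ c₂) (m₁ ∪ m₂)) :
    x ∈ G.hSet c₁ m₁ ∨ x ∈ G.uSet c₁ m₁ ∧ x ∈ (G.reduce c₁ m₁).hSet c₂ m₂ := by
  obtain ⟨ho, hxm⟩ := mem_hSet.1 hx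
  have ho₁ : x ∈ G.oSet c₁ := oSet_anti Finset.subset_union_left ho
  by_cases hx₁ : x ∈ m₁
  · exact .inl (mem_hSet.2 ⟨ho₁, hx₁⟩)
  · exact .inr ⟨mem_uSet.2 ⟨ho₁, hx₁⟩,
      (mem_hSet_reduce hG hm).2 ⟨ho, (Finset.mem_union.1 hxm).resolve_left hx₁, hx₁⟩⟩

theorem mem_hSet_union_lSet_reduce :
    j ∈ (G.reduce c₁ m₁).hSet c₂ m₂ ∪ (G.reduce c₁ m₁).lSet c₂ m₂ ↔
      j ∈ G.nodes \ (c₁ ∪ c₂) ∧ j ∈ m₂ ∧ j ∉ m₁ := by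
  rw [mem_hSet_union_lSet, nodes_reduce]
  simp only [Finset.mem_sdiff, Finset.mem_union]
  tauto

theorem Connects.of_reduce (hG : IsSummaryGraph G) (hm : Disjoint m₁ c₂)
    (h : (G.reduce c₁ m₁).Connects c₂ m₂ a b) : G.Connects (c₁ ∪ c₂) (m₁ ∪ m₂) a b := by
  refine Walk.flatten (fun {a p q b} h hpq h' => Walk.trans h ?_ h')
    (fun h => ((joins_reduce hG).1 h).2.2.mono hG hm) h
  have mem_h {x} (hx : x ∈ (G.reduce c₁ m₁).hSet c₂ m₂) : x ∈ G.hSet (c₁ ∪ c₂) (m₁ ∪ m₂) :=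
    let ⟨ho, hm₂, _⟩ := (mem_hSet_reduce hG hm).1 hx
    mem_hSet.2 ⟨ho, Finset.mem_union_right _ hm₂⟩
  rcases hpq with hpq | hpq
  · obtain ⟨hx⟩ := hpq
    exact .inl ⟨mem_rSet_union_of_mem_rSet_reduce hG hx⟩
  cases hpq with
  | up hx => exact .inr (.up (mem_h hx))
  | down hx => exact .inr (.down (mem_h hx))
  | tails hx =>
    obtain ⟨hn, hm₂, -⟩ := mem_hSet_union_lSet_reduce.1 hx
    exact .inr (.tails (mem_hSet_union_lSet.2 ⟨hn, Finset.mem_union_right _ hm₂⟩))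

theorem Connects.reduce (hG : IsSummaryGraph G) (hm : Disjoint m₁ c₂)
    (ha : (G.reduce c₁ m₁).IsEnd a) (hb : (G.reduce c₁ m₁).IsEnd b)
    (h : G.Connects (c₁ ∪ c₂) (m₁ ∪ m₂) a b) : (G.reduce c₁ m₁).Connects c₂ m₂ a b := by
  rw [Connects, show (G.reduce c₁ m₁).Joins = _ from funext₂ fun _ _ => propext (joins_reduce hG)]
  refine Walk.cut (fun p q hpq => ?_) ha hb h
  have mem_h {x} (hx : x ∈ G.hSet (c₁ ∪ c₂) (m₁ ∪ m₂)) := mem_hSet_or_mem_hSet_reduce hG hm hx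
  rcases hpq with hpq | hpq
  · obtain @⟨x, hx⟩ := hpq
    by_cases hx₁ : x ∈ G.rSet c₁
    · exact .inl (.inl ⟨hx₁⟩)
    obtain ⟨s, hs, hsx⟩ := exists_mem_rSet_reduce hG hm hx hx₁
    refine .inr ⟨head s, head s, rSet_subset hs, rSet_subset hs, .inl ⟨hs⟩, ?_⟩
    rcases hsx with rfl | ⟨hxh, hsx⟩
    · exact ⟨fun _ => id, fun _ => id⟩
    · exact ⟨fun _ h => Connects.trans h (.up hxh) (Connects.symm hG hsx),
        fun _ h => Connects.trans hsx (.down hxh) h⟩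
  cases hpq with
  | @tails x hx =>
    obtain ⟨hn, hx₂⟩ := mem_hSet_union_lSet.1 hx
    have hn₁ : x ∈ G.nodes \ c₁ := Finset.sdiff_subset_sdiff subset_rfl Finset.subset_union_left hn
    by_cases hx₁ : x ∈ m₁
    · exact .inl (.inr (.tails (mem_hSet_union_lSet.2 ⟨hn₁, hx₁⟩)))
    · have hxe : (G.reduce c₁ m₁).IsEnd (tail x) := mem_uSet_union_vSet.2 ⟨hn₁, hx₁⟩
      exact .inr ⟨tail x, tail x, hxe, hxe, .inr (.tails (mem_hSet_union_lSet_reduce.2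
        ⟨hn, (Finset.mem_union.1 hx₂).resolve_left hx₁, hx₁⟩)), fun _ => id, fun _ => id⟩
  | @up x hx =>
    rcases mem_h hx with hx₁ | ⟨hxu, hxh⟩
    · exact .inl (.inr (.up hx₁))
    · exact .inr ⟨head x, tail x, hxu, Finset.mem_union_left _ hxu, .inr (.up hxh),
        fun _ => id, fun _ => id⟩
  | @down x hx =>
    rcases mem_h hx with hx₁ | ⟨hxu, hxh⟩
    · exact .inl (.inr (.down hx₁))
    · exact .inr ⟨tail x, head x, Finset.mem_union_left _ hxu, hxu, .inr (.down hxh),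
        fun _ => id, fun _ => id⟩

theorem nodes_reduce_reduce :
    ((G.reduce c₁ m₁).reduce c₂ m₂).nodes = (G.reduce (c₁ ∪ c₂) (m₁ ∪ m₂)).nodes := by
  simp only [nodes_reduce]
  grind

theorem IsEnd.of_reduce (h : (G.reduce c₁ m₁).IsEnd a) : G.IsEnd a := by
  cases a with
  | head i => exact (mem_oSet.1 (mem_uSet.1 h).1).1
  | tail k =>
    replace h : k ∈ (G.reduce c₁ m₁).nodes := h
    rw [nodes_reduce] at h
    exact (Finset.mem_sdiff.1 h).1

theorem reduce_reduce (hG : IsSummaryGraph G) (hm : Disjoint m₁ c₂) :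
    (G.reduce c₁ m₁).reduce c₂ m₂ = G.reduce (c₁ ∪ c₂) (m₁ ∪ m₂) := by
  have hG₁ := isSummaryGraph_reduce hG c₁ m₁
  have hu : ((G.reduce c₁ m₁).reduce c₂ m₂).u = (G.reduce (c₁ ∪ c₂) (m₁ ∪ m₂)).u :=
    uSet_reduce hG hm
  have isEnd_iff (a) : ((G.reduce c₁ m₁).reduce c₂ m₂).IsEnd a ↔
      (G.reduce (c₁ ∪ c₂) (m₁ ∪ m₂)).IsEnd a := by
    cases a <;> simp only [IsEnd, hu, nodes_reduce_reduce]
  refine ext_of_joins (isSummaryGraph_reduce hG₁ c₂ m₂) (isSummaryGraph_reduce hG _ _) hu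
    nodes_reduce_reduce fun a b => ?_
  rw [joins_reduce hG₁, joins_reduce hG, ← isEnd_iff, ← isEnd_iff]
  refine and_congr_right fun ha => and_congr_right fun hb => ?_
  exact ⟨.of_reduce hG hm, .reduce hG hm ha.of_reduce hb.of_reduce⟩

end Successive

end EdgeMatrices

/-! ### Directed acyclic graphs as summary graphs -/

section Parent

open EdgeMatrices EdgeEnd

variable {V : Type*} [Fintype V] [LinearOrder V]

/-- The directed acyclic graph with edge matrix `A`, viewed as a summary graph without dashed and
full lines. -/
noncomputable def parentGraph (A : Matrix V V ℝ) : EdgeMatrices V where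
  u := Finset.univ
  v := ∅
  dir := A
  dash := 1
  full := 0

variable {A : Matrix V V ℝ} {C M : Finset V} {i j k : V}

theorem isSummaryGraph_parentGraph (hA : IsParentEdgeMatrix A) :
    IsSummaryGraph (parentGraph A) where
  disjoint := Finset.disjoint_empty_right _
  dir_binary := hA.binary
  dash_binary := isBinary_one
  full_binary _ _ := .inl rfl
  dir_supp i k _ := ⟨Finset.mem_univ i, Finset.mem_union_left _ (Finset.mem_univ k)⟩
  dash_supp i j _ := ⟨Finset.mem_univ i, Finset.mem_univ j⟩
  full_supp _ _ h := (h rfl).elim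
  dir_diag i _ := hA.diag i
  dash_diag _ _ := Matrix.one_apply_eq _
  full_diag _ h := (Finset.notMem_empty _ h).elim
  dir_upper i _ k _ := hA.upper i k
  dash_symm i j := by simp only [parentGraph, Matrix.one_apply, eq_comm]
  full_symm _ _ := rfl

theorem rSet_parentGraph : (parentGraph A).rSet C = C ∪ foster A Finset.univ C := by
  simp only [rSet, parentGraph, Finset.inter_univ]

theorem psiSet_parentGraph : (parentGraph A).psiSet C = (parentGraph A).rSet C :=
  Finset.union_empty _

theorem oSet_parentGraph : (parentGraph A).oSet C = (C ∪ foster A Finset.univ C)ᶜ := by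
  rw [oSet, rSet_parentGraph, Finset.compl_eq_univ_sdiff]
  rfl

theorem phiSet_parentGraph : (parentGraph A).phiSet C = foster A Finset.univ C := by
  rw [phiSet, psiSet_parentGraph, rSet_parentGraph, Finset.union_sdiff_cancel_left]
  exact Finset.disjoint_right.2 fun _ h => (mem_foster.1 h).2.1

theorem nodes_parentGraph : (parentGraph A).nodes = Finset.univ := Finset.union_empty _

theorem Q_parentGraph : (parentGraph A).Q C = 1 := zer_one

theorem Spsi_parentGraph (hA : IsParentEdgeMatrix A) :
    (parentGraph A).Spsi C = ind ((blk ((parentGraph A).rSet C) ((parentGraph A).rSet C) A)ᵀ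
      * blk ((parentGraph A).rSet C) ((parentGraph A).rSet C) A) := by
  have : NonnegEntries A := IsBinary.nonnegEntries hA.binary
  refine isBinary_Spsi.ext (isBinary_ind _) fun i j => ?_
  rw [Spsi, Q_parentGraph, psiSet_parentGraph, show (parentGraph A).full = 0 from rfl, zero_add]
  simp only [parentGraph, ind_ne_zero, mul_ne_zero, blk_ne_zero, one_ne_zero_iff,
    Matrix.transpose_apply]
  grind

theorem colliderWalk_head_tail_parentGraph (hA : IsParentEdgeMatrix A)
    (hi : i ∈ (parentGraph A).oSet C) :
    (parentGraph A).ColliderWalk C (head i) (tail k) ↔ A i k ≠ 0 := by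
  rw [colliderWalk_head_tail (isSummaryGraph_parentGraph hA), Q_parentGraph]
  refine or_iff_left ?_
  rintro ⟨x, hx, h, -⟩
  exact (mem_oSet.1 hi).2 (one_ne_zero_iff.1 h ▸ hx)

/-- The matrix `D = zer_p A` of the graph generated from a directed acyclic graph. -/
noncomputable def parentClosure (A : Matrix V V ℝ) (C M : Finset V) : Matrix V V ℝ :=
  zer ((parentGraph A).hSet C M) A

instance : NonnegEntries (parentClosure A C M) := by unfold parentClosure; infer_instance

theorem parentClosure_ne_zero (hA : IsParentEdgeMatrix A) : parentClosure A C M i k ≠ 0 ↔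
    Walk (Pass ((parentGraph A).hSet C M)) (fun p q => A p q ≠ 0) i k := by
  refine (zer_ne_zero hA.binary).trans (or_iff_right_of_imp ?_)
  rintro ⟨-, rfl⟩
  exact .single (by simp [hA.diag i])

theorem parentClosure_self_ne_zero (hA : IsParentEdgeMatrix A) : parentClosure A C M i i ≠ 0 :=
  (parentClosure_ne_zero hA).2 (.single (by simp [hA.diag i]))

theorem connects_of_parentClosure_ne_zero (hA : IsParentEdgeMatrix A)
    (h : parentClosure A C M i k ≠ 0) : (parentGraph A).Connects C M (head i) (tail k) := by
  replace h := (parentClosure_ne_zero hA).1 h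
  induction h with
  | single h => exact .single h
  | snoc _ hpq hqb ih =>
    obtain ⟨hp, rfl⟩ := hpq
    exact ih.trans (.down hp) (.single hqb)

/-- A connecting walk between `head i` and `tail k` follows arrows against their direction until
it reaches `φ`, which it does not leave any more. -/
theorem connects_head_tail_parentGraph (hA : IsParentEdgeMatrix A)
    (hi : i ∈ (parentGraph A).oSet C) (hk : k ∉ C) :
    (parentGraph A).Connects C M (head i) (tail k) ↔
      parentClosure A C M i k ≠ 0 ∨ ∃ y ∈ (parentGraph A).lSet C M,
        parentClosure A C M i y ≠ 0 ∧
          (parentGraph A).Connects C M (tail y) (tail k) := by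
  have hG := isSummaryGraph_parentGraph hA
  constructor
  · intro h
    have hk' : k ∈ (parentGraph A).nodes \ C := by simp [nodes_parentGraph, hk]
    rw [← rowEnd_of_mem_oSet hi,
      ← walk_triangular_iff_connects hG (mem_nodes_sdiff_of_mem_oSet hi) hk'] at h
    clear hk hk'
    induction h with
    | single h =>
      have h := ((triangular_ne_zero hG).1 h).2.2
      rw [rowEnd_of_mem_oSet hi, colliderWalk_head_tail_parentGraph hA hi] at h
      exact .inl ((parentClosure_ne_zero hA).2 (.single h))
    | @snoc p _ k _ hpq hqb ih =>
      obtain ⟨hp, rfl⟩ := hpq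
      have h := ((triangular_ne_zero hG).1 hqb).2.2
      rcases Finset.mem_union.1 hp with hp' | hp'
      · have hpo := (mem_hSet.1 hp').1
        rw [rowEnd_of_mem_oSet hpo, colliderWalk_head_tail_parentGraph hA hpo] at h
        rcases ih with hD | ⟨y, -, -, hyp⟩
        · exact .inl ((parentClosure_ne_zero hA).2
            (((parentClosure_ne_zero hA).1 hD).snoc ⟨hp', rfl⟩ h))
        · exact (not_connects_tail_tail hG hpo hyp).elim
      · rw [rowEnd_of_mem_phiSet hG (mem_lSet.1 hp').1] at h
        rcases ih with hD | ⟨y, hy, hD, hyp⟩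
        exacts [.inr ⟨p, hp', hD, h.connects⟩,
          .inr ⟨y, hy, hD, hyp.trans (.tails hp) h.connects⟩]
  · rintro (h | ⟨y, hy, h, hyk⟩)
    exacts [connects_of_parentClosure_ne_zero hA h,
      (connects_of_parentClosure_ne_zero hA h).trans (.tails (Finset.mem_union_right _ hy)) hyk]

theorem connects_head_tail_parentGraph_of_mem_hSet (hA : IsParentEdgeMatrix A)
    (hi : i ∈ (parentGraph A).oSet C) (hk : k ∈ (parentGraph A).hSet C M) :
    (parentGraph A).Connects C M (head i) (tail k) ↔ parentClosure A C M i k ≠ 0 := by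
  have hko := (mem_hSet.1 hk).1
  have hkC := (Finset.mem_sdiff.1 (mem_nodes_sdiff_of_mem_oSet hko)).2
  refine (connects_head_tail_parentGraph hA hi hkC).trans (or_iff_left ?_)
  rintro ⟨y, -, -, h⟩
  exact not_connects_tail_tail (isSummaryGraph_parentGraph hA) hko h

theorem connects_head_tail_parentGraph_of_mem_lSet (hA : IsParentEdgeMatrix A)
    (hi : i ∈ (parentGraph A).oSet C) (hk : k ∈ (parentGraph A).lSet C M) :
    (parentGraph A).Connects C M (head i) (tail k) ↔ ∃ y ∈ (parentGraph A).lSet C M,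
      parentClosure A C M i y ≠ 0 ∧ (parentGraph A).Connects C M (tail y) (tail k) := by
  have hkφ := mem_phiSet.1 (mem_lSet.1 hk).1
  refine (connects_head_tail_parentGraph hA hi hkφ.2).trans (or_iff_right_of_imp fun h => ?_)
  exact ⟨k, hk, h, (colliderWalk_tail_tail_self (isSummaryGraph_parentGraph hA) hkφ.1).connects⟩

theorem connects_head_head_parentGraph (hA : IsParentEdgeMatrix A)
    (hi : i ∈ (parentGraph A).oSet C) (hj : j ∈ (parentGraph A).oSet C) :
    (parentGraph A).Connects C M (head i) (head j) ↔ i = j ∨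
      (∃ x ∈ (parentGraph A).hSet C M,
        parentClosure A C M i x ≠ 0 ∧ parentClosure A C M j x ≠ 0) ∨
      ∃ x ∈ (parentGraph A).lSet C M, ∃ y ∈ (parentGraph A).lSet C M,
        parentClosure A C M i x ≠ 0 ∧ (parentGraph A).Connects C M (tail x) (tail y) ∧
          parentClosure A C M j y ≠ 0 := by
  have hG := isSummaryGraph_parentGraph hA
  have D_self {i} : parentClosure A C M i i ≠ 0 := parentClosure_self_ne_zero hA
  have to_h {i x} (hi : i ∈ (parentGraph A).oSet C) (hx : x ∈ (parentGraph A).hSet C M) :=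
    connects_head_tail_parentGraph_of_mem_hSet hA hi hx
  have to_l {i x} (hi : i ∈ (parentGraph A).oSet C) (hx : x ∈ (parentGraph A).lSet C M) :=
    connects_head_tail_parentGraph_of_mem_lSet hA hi hx
  have link {x} (hx : x ∈ (parentGraph A).lSet C M) :
      (parentGraph A).NoncolliderLink C M (tail x) (tail x) :=
    .tails (Finset.mem_union_right _ hx)
  rw [connects_head_head_iff hG]
  simp only [← Q_ne_zero hG, Q_parentGraph, one_ne_zero_iff]
  constructor
  · rintro (⟨x, _, rfl | ⟨hx, hix⟩, rfl, rfl | ⟨hx', hjx⟩⟩ | ⟨x, hx, y, hy, hix, hxy, hjy⟩)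
    · exact .inl rfl
    · exact .inr (.inl ⟨x, hx', D_self, (to_h hj hx').1 hjx⟩)
    · exact .inr (.inl ⟨x, hx, (to_h hi hx).1 hix, D_self⟩)
    · exact .inr (.inl ⟨x, hx, (to_h hi hx).1 hix, (to_h hj hx).1 hjx⟩)
    · obtain ⟨x', hx', hix', hx'x⟩ := (to_l hi hx).1 hix
      obtain ⟨y', hy', hjy', hy'y⟩ := (to_l hj hy).1 hjy
      exact .inr (.inr ⟨x', hx', y', hy', hix',
        (hx'x.trans (link hx) hxy).trans (link hy) (Connects.symm hG hy'y), hjy'⟩)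
  · have tail_self {x} (hx : x ∈ (parentGraph A).lSet C M) :
        (parentGraph A).Connects C M (tail x) (tail x) :=
      (colliderWalk_tail_tail_self hG (mem_phiSet.1 (mem_lSet.1 hx).1).1).connects
    rintro (rfl | ⟨x, hx, hix, hjx⟩ | ⟨x, hx, y, hy, hix, hxy, hjy⟩)
    · exact .inl ⟨i, i, .inl rfl, rfl, .inl rfl⟩
    · exact .inl ⟨x, x, .inr ⟨hx, (to_h hi hx).2 hix⟩, rfl, .inr ⟨hx, (to_h hj hx).2 hjx⟩⟩
    · exact .inr ⟨x, hx, y, hy, (to_l hi hx).2 ⟨x, hx, hix, tail_self hx⟩, hxy,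
        (to_l hj hy).2 ⟨y, hy, hjy, tail_self hy⟩⟩

theorem ofParent_eq (hA : IsParentEdgeMatrix A) : ofParent A C M =
    let G := parentGraph A
    let h := G.hSet C M
    let l := G.lSet C M
    let u := G.uSet C M
    let v := G.vSet C M
    let D := parentClosure A C M
    let Z := G.Z C M
    { u := u
      v := v
      dir := blk u u D + ind (blk u v D + blk u l D * blk l v Z)
      dash := ind (blk u u 1 + blk u h D * (blk u h D)ᵀ + blk u l D * blk l l Z * (blk u l D)ᵀ)
      full := blk v v Z } := by
  simp only [ofParent, Z, parentClosure, Spsi_parentGraph hA, uSet, vSet, hSet, lSet,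
    rSet_parentGraph, oSet_parentGraph, phiSet_parentGraph]

theorem ofParent_dir_ne_zero (hA : IsParentEdgeMatrix A) : (ofParent A C M).dir i k ≠ 0 ↔
    i ∈ (parentGraph A).uSet C M ∧ k ∈ (parentGraph A).uSet C M ∪ (parentGraph A).vSet C M ∧
      (parentGraph A).Connects C M (head i) (tail k) := by
  have hG := isSummaryGraph_parentGraph hA
  have D_iff (hi : i ∈ (parentGraph A).uSet C M)
      (hk : k ∈ (parentGraph A).uSet C M ∪ (parentGraph A).vSet C M) :=
    connects_head_tail_parentGraph (M := M) hA (mem_uSet.1 hi).1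
      (Finset.mem_sdiff.1 (mem_uSet_union_vSet.1 hk).1).2
  have Z_iff {y} (hy : y ∈ (parentGraph A).lSet C M) (hk : k ∈ (parentGraph A).vSet C M) :=
    Z_ne_zero (m := M) hG (mem_lSet.1 hy).1 (mem_vSet.1 hk).1
  have no_tail {y} (hk : k ∈ (parentGraph A).uSet C M) :
      ¬ (parentGraph A).Connects C M (tail y) (tail k) :=
    not_connects_tail_tail hG (mem_uSet.1 hk).1
  rw [ofParent_eq hA]
  simp only [add_ne_zero, ind_ne_zero, mul_ne_zero, blk_ne_zero]
  grind

theorem ofParent_dash_ne_zero (hA : IsParentEdgeMatrix A) : (ofParent A C M).dash i j ≠ 0 ↔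
    i ∈ (parentGraph A).uSet C M ∧ j ∈ (parentGraph A).uSet C M ∧
      (parentGraph A).Connects C M (head i) (head j) := by
  have hG := isSummaryGraph_parentGraph hA
  have dash_iff (hi : i ∈ (parentGraph A).uSet C M) (hj : j ∈ (parentGraph A).uSet C M) :=
    connects_head_head_parentGraph (M := M) hA (mem_uSet.1 hi).1 (mem_uSet.1 hj).1
  have Z_iff {x y} (hx : x ∈ (parentGraph A).lSet C M) (hy : y ∈ (parentGraph A).lSet C M) :=
    Z_ne_zero (m := M) hG (mem_lSet.1 hx).1 (mem_lSet.1 hy).1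
  rw [ofParent_eq hA]
  simp only [add_ne_zero, ind_ne_zero, mul_ne_zero, blk_ne_zero, one_ne_zero_iff,
    Matrix.transpose_apply]
  grind

theorem isBinary_ofParent_dir (hA : IsParentEdgeMatrix A) : IsBinary (ofParent A C M).dir := by
  have hG := isSummaryGraph_parentGraph hA
  rw [ofParent_eq hA]
  refine .add (.blk (isBinary_zer _ _) _ _) (isBinary_ind _) fun i k h => ?_
  have hk : k ∉ (parentGraph A).vSet C M := fun hv =>
    notMem_phiSet_of_mem_oSet hG (mem_uSet.1 (blk_ne_zero.1 h).2.1).1 (mem_vSet.1 hv).1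
  by_contra h'
  simp only [← ne_eq, ind_ne_zero, add_ne_zero, mul_ne_zero, blk_ne_zero] at h'
  tauto

theorem ofParent_eq_reduce (hA : IsParentEdgeMatrix A) :
    ofParent A C M = (parentGraph A).reduce C M := by
  have hG := isSummaryGraph_parentGraph hA
  refine EdgeMatrices.ext (by rw [ofParent_eq hA]; rfl) (by rw [ofParent_eq hA]; rfl) ?_ ?_
    (by rw [ofParent_eq hA]; rfl)
  · exact (isBinary_ofParent_dir hA).ext (isBinary_reduce_dir hG) fun i k =>
      (ofParent_dir_ne_zero hA).trans (reduce_dir_ne_zero hG).symm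
  · exact IsBinary.ext (isBinary_ind _) (isBinary_ind _) fun i j =>
      (ofParent_dash_ne_zero hA).trans (reduce_dash_ne_zero hG).symm

end Parent

end SummaryGraphs

open SummaryGraphs in
theorem corollary5 {V : Type*} [Fintype V] [LinearOrder V] :
    -- the components for `[C, M]` result from those for `[c, m]`
    (∀ A : Matrix V V ℝ, IsParentEdgeMatrix A →
      ∀ c m C M : Finset V, c ⊆ C → m ⊆ M → Disjoint C M →
        IsSummaryGraph (ofParent A C M) ∧
        (ofParent A C M).nodes = (C ∪ M)ᶜ ∧
        ofParent A C M = (ofParent A c m).reduce (C \ c) (M \ m)) ∧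
    -- summary graphs are closed under conditioning and marginalising
    (∀ G : EdgeMatrices V, IsSummaryGraph G →
      ∀ c m : Finset V, c ⊆ G.nodes → m ⊆ G.nodes → Disjoint c m →
        IsSummaryGraph (G.reduce c m) ∧
        (G.reduce c m).nodes = G.nodes \ (c ∪ m)) ∧
    -- in any order and in any number of steps
    (∀ G : EdgeMatrices V, IsSummaryGraph G →
      ∀ c₁ m₁ c₂ m₂ : Finset V,
        c₁ ⊆ G.nodes → m₁ ⊆ G.nodes → c₂ ⊆ G.nodes → m₂ ⊆ G.nodes →
        Disjoint c₁ c₂ → Disjoint m₁ m₂ → Disjoint (c₁ ∪ c₂) (m₁ ∪ m₂) →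
        (G.reduce c₁ m₁).reduce c₂ m₂ = G.reduce (c₁ ∪ c₂) (m₁ ∪ m₂)) := by
  refine ⟨fun A hA c m C M hc hm hCM => ?_,
    fun G hG c m _ _ _ => ⟨EdgeMatrices.isSummaryGraph_reduce hG c m, EdgeMatrices.nodes_reduce⟩,
    fun G hG c₁ m₁ c₂ m₂ _ _ _ _ _ _ h => EdgeMatrices.reduce_reduce hG
      (h.mono Finset.subset_union_right Finset.subset_union_left).symm⟩
  have hG := isSummaryGraph_parentGraph hA
  have hmC : Disjoint m (C \ c) := (hCM.mono Finset.sdiff_subset hm).symm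
  simp only [ofParent_eq_reduce hA]
  refine ⟨EdgeMatrices.isSummaryGraph_reduce hG C M, ?_, ?_⟩
  · rw [EdgeMatrices.nodes_reduce, nodes_parentGraph, Finset.compl_eq_univ_sdiff]
  · rw [EdgeMatrices.reduce_reduce hG hmC, Finset.union_sdiff_of_subset hc,
      Finset.union_sdiff_of_subset hm]
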